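/- All simplicial complexes are finite and regular, i.e. piecewise Euclidean with every edge of length $1$. A subcomplex $L\subseteq K$ is *full* if every simplex of $K$ whose vertices all lie in $L$ lies in $L$. For a simplex $s$ of $K$, the *metric link* $lk_K(s)$ is the spherical complex whose cells are, for the simplices $t\supseteq s$ of $K$, the sets of unit vectors orthogonal to $s$ and pointing into $t$; it carries its intrinsic (length) metric. A *locally geodesic loop* of length $\ell$ is a locally isometric embedding of the metric circle of length $\ell>0$. $K$ is *nonpositively curved* if no link of a simplex of $K$ contains a locally geodesic loop of length less than $2\pi$, and *CAT(0)* if moreover it is connected and simply connected. A *disk spanning* a simple combinatorial loop $\alpha$ in $K$ is a triangulated closed disk $D$ with a simplicial map $D\to K$ carrying the boundary loop of $D$ to $\alpha$; it is *minimal* if the number of its triangles is the least possible. A simple loop of length $5$ in the $1$-skeleton is an *empty pentagon* if it has minimal spanning disks and each of them has an interior vertex. **Example (High Dimensional Empty Pentagon).** Let $n\ge 4$, let $\sigma$ be an $(n-2)$-simplex, let $\alpha$ be a cycle with five distinct vertices $v_i$ and edges $\{v_i,v_{i+1}\}$ ($i\in\mathbb Z/5$), and let $K=\sigma*\alpha$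 be their join. Then: 1. $K$ is an $n$-dimensional complex, the union of its exactly five $n$-simplices $\sigma*\{v_i,v_{i+1}\}$, arranged cyclically around $\sigma$. 2. $lk_K(\sigma)$ is a metric graph consisting of a single cycle of five edges, each of length $\arccos(1/n)$, and $5\arccos(1/n)>2\pi$. The curvature of $K$ depends only on $lk_K(\sigma)$: for every other simplex $s$ of $K$, $lk_K(s)$ contains no locally geodesic loop at all. 3. $K$ is CAT(0). 4. $\alpha$ is an empty pentagon in $K$. There are exactly $n-1$ minimal disks spanning $\alpha$ in $K$, one through each vertex of $\sigma$: every minimal spanning disk is mapped injectively to $K$, and the images of the minimal spanning disks are precisely the $n-1$ distinct subcomplexes $L_v=v*\alpha$, for $v$ a vertex of $\sigma$. 5. For each vertex $v$ of $\sigma$, the complex $L_v$ is the full subcomplex of $K$ on the vertices $v,v_0,\dots,v_4$. It is a disk with boundary $\alpha$ that consists of five triangles $\{v,v_i,v_{i+1}\}$ around its one interior vertex $v$. It is positively curved at $v$: $lk_{L_v}(v)$ is a single cycle of five edges of length $\pi/3$, of total length $5\pi/3<2\pi$; in particular $L_v$ is not nonpositively curved. 6. Hence for every $n\ge4$ the assertion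 "every full subcomplex of a CAT(0) regular simplicial $n$-complex is nonpositively curved" is false. -/

import Mathlib

open Set Metric Real
open scoped ENNReal

noncomputable section

namespace PECurvature

/-! ### Combinatorics of finite simplicial complexes

Simplicial complexes are given by their nonempty faces (`PreAbstractSimplicialComplex`), a simplex
being identified with its vertex set.  Subcomplexes are given by `L ≤ K`. -/

section Combinatorics

variable {V W : Type*}

/-- `K` has dimension `d`: the largest simplices of `K` are `d`-simplices. -/
def HasDim (K : PreAbstractSimplicialComplex V) (d : ℕ) : Prop :=
  (∃ s ∈ K, s.card = d + 1) ∧ ∀ s ∈ K, s.card ≤ d + 1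

/-- `L` is a full subcomplex of `K`: a simplex of `K` all of whose vertices lie in `L` lies
in `L`. -/
def IsFull (L K : PreAbstractSimplicialComplex V) : Prop :=
  L ≤ K ∧ ∀ s ∈ K, (∀ v ∈ s, {v} ∈ L) → s ∈ L

/-- The subcomplex of `K` consisting of all simplices with vertices in `S`. -/
def spanned (K : PreAbstractSimplicialComplex V) (S : Set V) : PreAbstractSimplicialComplex V where
  faces := {s | s ∈ K ∧ (s : Set V) ⊆ S}
  isRelLowerSet_faces := fun {_} ⟨hs, hS⟩ =>
    ⟨(K.isRelLowerSet_faces hs).1, fun _ hts ht =>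
      ⟨(K.isRelLowerSet_faces hs).2 hts ht, (Finset.coe_subset.2 hts).trans hS⟩⟩

/-- The join `K * L`: its simplices are the `s ⊔ t` with `s` a simplex of `K` or empty, `t` a
simplex of `L` or empty, and not both empty. -/
def join (K : PreAbstractSimplicialComplex V) (L : PreAbstractSimplicialComplex W) :
    PreAbstractSimplicialComplex (V ⊕ W) where
  faces := {s | s.Nonempty ∧ (s.toLeft = ∅ ∨ s.toLeft ∈ K) ∧ (s.toRight = ∅ ∨ s.toRight ∈ L)}
  isRelLowerSet_faces := fun {s} ⟨hs, hl, hr⟩ => ⟨hs, fun t hts ht => by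
    have hL : t.toLeft ⊆ s.toLeft := Finset.toLeft_subset_toLeft hts
    have hR : t.toRight ⊆ s.toRight := Finset.toRight_subset_toRight hts
    refine ⟨ht, ?_, ?_⟩
    · rcases Finset.eq_empty_or_nonempty t.toLeft with h | h
      · exact Or.inl h
      · rcases hl with h' | h'
        · exact Or.inl (Finset.subset_empty.1 (h' ▸ hL))
        · exact Or.inr ((K.isRelLowerSet_faces h').2 hL h)
    · rcases Finset.eq_empty_or_nonempty t.toRight with h | h
      · exact Or.inl h
      · rcases hr with h' | h'
        · exact Or.inl (Finset.subset_empty.1 (h' ▸ hR))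
        · exact Or.inr ((L.isRelLowerSet_faces h').2 hR h)⟩

/-- The cycle with vertices `i : ZMod k` and edges `{i, i + 1}`. -/
def cycleComplex (k : ℕ) : PreAbstractSimplicialComplex (ZMod k) where
  faces := {s | s.Nonempty ∧ ∃ i : ZMod k, s ⊆ {i, i + 1}}
  isRelLowerSet_faces := fun {_} ⟨hs, i, hi⟩ => ⟨hs, fun _ hts ht => ⟨ht, i, hts.trans hi⟩⟩

end Combinatorics

/-! ### The regular piecewise Euclidean structure and metric links -/

section Geometry

variable {V : Type*} [Fintype V] [DecidableEq V]

/-- The position of the vertex `v` in the Euclidean space `ℝ^V`, scaled so that all edges have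
length one (`dist_pt`). -/
def pt (v : V) : EuclideanSpace ℝ V := (√2)⁻¹ • EuclideanSpace.single v (1 : ℝ)

theorem dist_pt {v w : V} (h : v ≠ w) : dist (pt v) (pt w) = 1 := by
  have h1 : dist (pt v) (pt w) ^ 2 = 1 := by
    have e : inner ℝ (EuclideanSpace.single v (1 : ℝ)) (EuclideanSpace.single w (1 : ℝ)) = 0 := by
      simp [EuclideanSpace.inner_single_left, h]
    rw [pt, pt, dist_eq_norm, ← smul_sub, norm_smul, mul_pow, norm_sub_sq_real, e]
    norm_num
  exact (pow_eq_one_iff_of_nonneg dist_nonneg two_ne_zero).1 h1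

/-- The regular Euclidean simplex with vertex set `s`. -/
def cell (s : Finset V) : Set (EuclideanSpace ℝ V) := convexHull ℝ (pt '' (s : Set V))

/-- The space underlying the regular simplicial complex `K`. -/
def realization (K : PreAbstractSimplicialComplex V) : Set (EuclideanSpace ℝ V) :=
  ⋃ s ∈ K, cell s

/-- The barycenter of the simplex with vertex set `s`. -/
def barycenter (s : Finset V) : EuclideanSpace ℝ V := (s.card : ℝ)⁻¹ • ∑ v ∈ s, pt v

/-- The metric link of the simplex `s` in the simplex `t`: the unit vectors that are orthogonal
to `s` and that point, from the barycenter of `s`, into `t`. -/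
def linkCell (s t : Finset V) : Set (EuclideanSpace ℝ V) :=
  {u | ‖u‖ = 1 ∧ (∀ v ∈ s, ∀ w ∈ s, inner ℝ u (pt v - pt w) = 0) ∧
    ∃ ε : ℝ, 0 < ε ∧ barycenter s + ε • u ∈ cell t}

/-- The metric link `lk_K(s)`, the spherical complex with the cells `linkCell s t`, for the
simplices `t ⊇ s` of `K`. -/
def link (K : PreAbstractSimplicialComplex V) (s : Finset V) : Set (EuclideanSpace ℝ V) :=
  ⋃ t ∈ {t | t ∈ K ∧ s ⊆ t}, linkCell s t

/-- `w 0, …, w m` is a string in `lk_K(s)`: consecutive points lie in a common cell. -/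
def IsString (K : PreAbstractSimplicialComplex V) (s : Finset V) (m : ℕ)
    (w : ℕ → EuclideanSpace ℝ V) : Prop :=
  ∀ i < m, ∃ t ∈ K, s ⊆ t ∧ w i ∈ linkCell s t ∧ w (i + 1) ∈ linkCell s t

/-- The intrinsic metric of the spherical complex `lk_K(s)`: the infimum of the lengths of the
strings from `u` to `v` (infinite if there are none), where the distance of two points of a common
cell is their angular distance in the unit sphere. -/
def linkEDist (K : PreAbstractSimplicialComplex V) (s : Finset V)
    (u v : EuclideanSpace ℝ V) : ℝ≥0∞ :=
  ⨅ (m : ℕ) (w : ℕ → EuclideanSpace ℝ V) (_ : w 0 = u ∧ w m = v ∧ IsString K s m w),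
    ∑ i ∈ Finset.range m, ENNReal.ofReal (InnerProductGeometry.angle (w i) (w (i + 1)))

/-- `ρ` is a locally geodesic loop of length `ℓ` in `lk_K(s)`: an embedding of the metric circle
of length `ℓ` that is locally isometric for the intrinsic metric of the link. -/
structure IsLocallyGeodesicLoop (K : PreAbstractSimplicialComplex V) (s : Finset V) (ℓ : ℝ)
    (ρ : AddCircle ℓ → EuclideanSpace ℝ V) : Prop where
  pos : 0 < ℓ
  mem : ∀ x, ρ x ∈ link K s
  injective : Function.Injective ρ
  isometric : ∀ x, ∃ ε : ℝ, 0 < ε ∧ ∀ y ∈ ball x ε, ∀ z ∈ ball x ε,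
    linkEDist K s (ρ y) (ρ z) = edist y z

/-- `K` is nonpositively curved: no link of a simplex contains a locally geodesic loop of length
less than `2π`. -/
def IsNPC (K : PreAbstractSimplicialComplex V) : Prop :=
  ∀ s ∈ K, ∀ (ℓ : ℝ) (ρ : AddCircle ℓ → EuclideanSpace ℝ V),
    IsLocallyGeodesicLoop K s ℓ ρ → 2 * π ≤ ℓ

/-- `K` is CAT(0): nonpositively curved, connected and simply connected. -/
def IsCAT0 (K : PreAbstractSimplicialComplex V) : Prop :=
  IsNPC K ∧ ConnectedSpace (realization K) ∧ SimplyConnectedSpace (realization K)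

/-- `lk_K(s)` is a regular metric graph that is a single cycle of `k` edges, each of length `a`:
there is an isometry `ρ` of the circle of length `k * a` onto the link, which carries the `i`-th of
the `k` arcs of length `a` onto the cell of the simplex `t i`, and these cells and their common end
points, the cells of the simplices `t i ∩ t (i + 1)`, are all the nonempty cells of the link. -/
def LinkIsCycle (K : PreAbstractSimplicialComplex V) (s : Finset V) (k : ℕ) (a : ℝ)
    (t : ZMod k → Finset V) : Prop :=
  0 < a ∧ Function.Injective t ∧ (∀ i, t i ∈ K ∧ s ⊆ t i) ∧
  (∀ r ∈ K, s ⊂ r → (∃ i, r = t i) ∨ ∃ i, r = t i ∩ t (i + 1)) ∧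
  ∃ ρ : AddCircle (k * a) → EuclideanSpace ℝ V,
    range ρ = link K s ∧
    (∀ x y, linkEDist K s (ρ x) (ρ y) = edist x y) ∧
    (∀ i : ℕ, ρ '' ((fun x : ℝ => (x : AddCircle (k * a))) '' Icc (i * a) ((i + 1) * a)) =
      linkCell s (t i)) ∧
    ∀ i : ℕ, linkCell s (t i ∩ t (i + 1)) = {ρ (((i + 1) * a : ℝ) : AddCircle (k * a))}

end Geometry

/-! ### Disk diagrams and spanning disks -/

section Disks

variable {V : Type*}

/-- `D` is a (nonsingular) simplicial disk whose boundary is the combinatorial loop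
`b 0, b 1, …, b (k - 1), b k = b 0`: its space is homeomorphic to the closed unit disk, in such a
way that the union of the edges `{b i, b (i + 1)}` corresponds to the unit circle. -/
def IsSimplicialDisk [Fintype V] [DecidableEq V] (D : PreAbstractSimplicialComplex V) {k : ℕ}
    (b : ZMod k → V) : Prop :=
  (∀ s ∈ D, s.card ≤ 3) ∧ Function.Injective b ∧ (∀ i, {b i, b (i + 1)} ∈ D) ∧
  ∃ h : realization D ≃ₜ closedBall (0 : ℂ) 1,
    ∀ x : realization D, ‖(h x : ℂ)‖ = 1 ↔ ∃ i, (x : EuclideanSpace ℝ V) ∈ cell {b i, b (i + 1)}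

/-- A disk diagram spanning the simple loop `α` in `K`: a simplicial disk `diagram` with a
simplicial map to `K` that carries the boundary loop of the disk to `α`. -/
structure SpanningDisk [DecidableEq V] (K : PreAbstractSimplicialComplex V) {k : ℕ}
    (α : ZMod k → V) where
  /-- the number of available vertices of the disk -/
  size : ℕ
  /-- the simplicial disk -/
  diagram : PreAbstractSimplicialComplex (Fin size)
  /-- its boundary loop -/
  bdry : ZMod k → Fin size
  isDisk : IsSimplicialDisk diagram bdry
  /-- the map to `K`, on vertices -/
  toFun : Fin size → V
  map_mem : ∀ s ∈ diagram, s.image toFun ∈ K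
  map_bdry : ∀ i, toFun (bdry i) = α i

namespace SpanningDisk

variable [DecidableEq V] {K : PreAbstractSimplicialComplex V} {k : ℕ} {α : ZMod k → V}

/-- The combinatorial area: the number of triangles. -/
def area (D : SpanningDisk K α) : ℕ := {s | s ∈ D.diagram ∧ s.card = 3}.ncard

/-- `D` has minimal combinatorial area among the disks that span `α` in `K`. -/
def IsMinimal (D : SpanningDisk K α) : Prop := ∀ D' : SpanningDisk K α, D.area ≤ D'.area

/-- The image of the disk, a subcomplex of `K`. -/
def image (D : SpanningDisk K α) : PreAbstractSimplicialComplex V := D.diagram.map D.toFun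

end SpanningDisk

/-- The simple loop `α` of length `k` in `K` is an empty `k`-gon: there is a minimal disk spanning
`α`, and each such disk has an interior vertex. -/
def IsEmptyPolygon [DecidableEq V] (K : PreAbstractSimplicialComplex V) {k : ℕ} (α : ZMod k → V) :
    Prop :=
  Function.Injective α ∧ (∀ i, {α i, α (i + 1)} ∈ K) ∧
  (∃ D : SpanningDisk K α, D.IsMinimal) ∧
  ∀ D : SpanningDisk K α, D.IsMinimal → ∃ w, {w} ∈ D.diagram ∧ w ∉ range D.bdry

end Disks

/-! ### The complexes of the example -/

/-- Full subcomplexes of (finite) regular CAT(0) simplicial `n`-complexes are nonpositively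
curved. -/
def FullSubcomplexesAreNPC (n : ℕ) : Prop :=
  ∀ (V : Type) [Fintype V] [DecidableEq V] (K L : PreAbstractSimplicialComplex V),
    HasDim K n → IsCAT0 K → IsFull L K → IsNPC L

/-- The join of an `(n - 2)`-simplex (all nonempty sets of its `n - 1` vertices) and a 5-cycle. -/
def pentagonJoin (n : ℕ) : PreAbstractSimplicialComplex (Fin (n - 1) ⊕ ZMod 5) :=
  join (⊤ : PreAbstractSimplicialComplex (Fin (n - 1))) (cycleComplex 5)

/-- The `(n - 2)`-simplex `σ` of the join. -/
def core (n : ℕ) : Finset (Fin (n - 1) ⊕ ZMod 5) := Finset.univ.map Function.Embedding.inl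

/-- The 5-cycle of the join. -/
def pentagon (n : ℕ) : ZMod 5 → Fin (n - 1) ⊕ ZMod 5 := Sum.inr

/-- The `i`-th `n`-simplex of the join. -/
def topSimplex (n : ℕ) (i : ZMod 5) : Finset (Fin (n - 1) ⊕ ZMod 5) :=
  core n ∪ {pentagon n i, pentagon n (i + 1)}

/-- The full subcomplex of the join spanned by the vertex `v` of `σ` and the 5-cycle. -/
def coneDisk (n : ℕ) (v : Fin (n - 1)) : PreAbstractSimplicialComplex (Fin (n - 1) ⊕ ZMod 5) :=
  spanned (pentagonJoin n) ({Sum.inl v} ∪ range (pentagon n))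

/-- The triangle of `coneDisk n v` on the `i`-th edge of the 5-cycle. -/
def coneTriangle (n : ℕ) (v : Fin (n - 1)) (i : ZMod 5) : Finset (Fin (n - 1) ⊕ ZMod 5) :=
  {Sum.inl v, pentagon n i, pentagon n (i + 1)}

end PECurvature

end

open PECurvature

set_option linter.unusedSectionVars false

namespace PECurvature

/-! ### Coordinate descriptions of cells and metric links -/

section Coordinates

variable {V : Type*} [Fintype V] [DecidableEq V]

/-! Curvature. Let `s` be a simplex of the join other than σ. If `s` misses a vertex `w` of σ, the
join is a cone with apex `w`, so each cell of the link of `s` lies in a cell that reaches towards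
`w`. Along a locally geodesic loop, take a point farthest from the direction of `w`, that is, one
where the inner product with that direction is least. Pushing this point towards `w` shortens the
loop nearby, a contradiction (`angle_push_lt`, `not_isLocallyGeodesicLoop_of_cone`). If `s` properly
contains σ, its link is finite. Only the link of σ remains. The directions of two vertices off an
`m`-vertex simplex have inner product `1 / (m + 1)`, so this link is a circle made of five arcs of
length `arccos (1 / n)` (`linkIsCycle`). Since `cos (2π/5) = (√5 - 1)/4 > 1/4 ≥ 1/n`, the circle is
longer than `2π`, and a closed local geodesic in a circle is at least as long as the circle
(`le_of_isometric_of_eq`). The join is star-shaped about a vertex of σ, hence contractible, so it is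
CAT(0). In the cone over the pentagon the same computation with `m = 1` gives five arcs of length
`π/3`, a loop shorter than `2π`.

Spanning disks. A simplex of the join meets the pentagon in at most an edge. Hence in any spanning
disk the triangles on the five boundary edges are distinct, and the area is at least five; the cones
attain it. In a disk of area five, these are all the triangles, and the third vertex of each is
interior. The edge from that vertex to a boundary vertex is not in the boundary circle, so it lies
in another triangle, which must be the neighbouring one. So all the third vertices agree and the
disk is a cone; its apex must map into σ, since no vertex of the pentagon is adjacent to all five
(`SpanningDisk.exists_eq_coneCycle`).

The topology of the disk enters through two facts: every simplex lies in a triangle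
(`exists_triangle`), because an open planar set does not inject continuously into a line, and an
edge contained in only one triangle is a boundary edge (`norm_eq_one_of_unique_triangle`), because a
circle around a point cannot be contracted off that point. -/

theorem pt_apply (v x : V) : pt v x = if x = v then (√2)⁻¹ else 0 := by
  simp [pt]

theorem sum_pt (v : V) : ∑ x, pt v x = (√2)⁻¹ := by
  simp [pt_apply]

theorem inner_pt_sub_pt (u : EuclideanSpace ℝ V) (v w : V) :
    inner ℝ u (pt v - pt w) = (√2)⁻¹ * (u v - u w) := by
  rw [inner_sub_right, pt, pt, real_inner_smul_right, real_inner_smul_right,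
    EuclideanSpace.inner_single_right, EuclideanSpace.inner_single_right]
  simp [mul_sub]

theorem mem_cell_iff {s : Finset V} {x : EuclideanSpace ℝ V} :
    x ∈ cell s ↔ (∀ v, 0 ≤ x v) ∧ (∀ v ∉ s, x v = 0) ∧ ∑ v, x v = (√2)⁻¹ := by
  constructor
  · intro hx
    have hc : Convex ℝ {x : EuclideanSpace ℝ V | (∀ v, 0 ≤ x v) ∧ (∀ v ∉ s, x v = 0) ∧
        ∑ v, x v = (√2)⁻¹} := by
      rintro x ⟨h1, h2, h3⟩ y ⟨g1, g2, g3⟩ a b ha hb hab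
      refine ⟨fun v => ?_, fun v hv => ?_, ?_⟩
      · have := mul_nonneg ha (h1 v)
        have := mul_nonneg hb (g1 v)
        simp; linarith
      · simp [h2 v hv, g2 v hv]
      · simp [Finset.sum_add_distrib, ← Finset.mul_sum, h3, g3, ← add_mul, hab]
    refine convexHull_min ?_ hc hx
    rintro _ ⟨v, hv, rfl⟩
    refine ⟨fun x => ?_, fun x hx => ?_, sum_pt v⟩
    · rw [pt_apply]; split_ifs <;> positivity
    · rw [pt_apply, if_neg]; rintro rfl; exact hx hv
  · rintro ⟨h1, h2, h3⟩
    -- The factor `√2` undoes the scaling of `pt` and turns coordinates into barycentric weights.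
    have e : x = ∑ v ∈ s, (√2 * x v) • pt v := by
      ext y
      simp only [WithLp.ofLp_sum, Finset.sum_apply, PiLp.smul_apply, pt_apply, smul_eq_mul,
        mul_ite, mul_zero, Finset.sum_ite_eq]
      split_ifs with h
      · field_simp
      · exact h2 y h
    rw [e]
    refine (convex_convexHull ℝ _).sum_mem (fun v _ => mul_nonneg (by positivity) (h1 v)) ?_
      fun v hv => subset_convexHull ℝ _ ⟨v, hv, rfl⟩
    rw [← Finset.mul_sum, Finset.sum_subset (Finset.subset_univ s) fun v _ hv => h2 v hv, h3]
    field_simp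

theorem cell_mono {s t : Finset V} (h : s ⊆ t) : cell s ⊆ cell t :=
  convexHull_mono (image_mono (Finset.coe_subset.2 h))

theorem barycenter_apply (s : Finset V) (x : V) :
    barycenter s x = if x ∈ s then (s.card : ℝ)⁻¹ * (√2)⁻¹ else 0 := by
  simp [barycenter, pt_apply]

/-- Orthogonality to `s` means constancy on `s`, and the zero sum keeps the ray in the affine
hyperplane of the cells. The barycenter has positive coordinates on `s`, so nonnegativity of `u` is
needed only off `s`. -/
theorem mem_linkCell_iff {s t : Finset V} (hs : s.Nonempty) (hst : s ⊆ t)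
    {u : EuclideanSpace ℝ V} :
    u ∈ linkCell s t ↔ ‖u‖ = 1 ∧ (∀ v ∈ s, ∀ w ∈ s, u v = u w) ∧ (∀ v ∉ s, 0 ≤ u v) ∧
      (∀ v ∉ t, u v = 0) ∧ ∑ v, u v = 0 := by
  have hcard : (0 : ℝ) < s.card := by exact_mod_cast hs.card_pos
  have hsum : ∑ v, barycenter s v = (√2)⁻¹ := by
    simp only [barycenter_apply, Finset.sum_ite_mem, Finset.univ_inter, Finset.sum_const,
      nsmul_eq_mul]
    field_simp
  have hinner : (∀ v ∈ s, ∀ w ∈ s, inner ℝ u (pt v - pt w) = 0) ↔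
      ∀ v ∈ s, ∀ w ∈ s, u v = u w := by
    simp [inner_pt_sub_pt, sub_eq_zero]
  rw [linkCell, mem_ofPred_eq, hinner]
  refine and_congr_right fun hu => and_congr_right fun _ => ?_
  constructor
  · rintro ⟨ε, hε, h⟩
    obtain ⟨h1, h2, h3⟩ := mem_cell_iff.1 h
    refine ⟨fun v hv => ?_, fun v hv => ?_, ?_⟩
    · have := h1 v
      simp only [PiLp.add_apply, barycenter_apply, hv, if_false, PiLp.smul_apply, zero_add,
        smul_eq_mul] at this
      exact nonneg_of_mul_nonneg_right this hε
    · have := h2 v hv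
      have hvs : v ∉ s := fun h => hv (hst h)
      simpa [barycenter_apply, hvs, hε.ne'] using this
    · simp only [PiLp.add_apply, PiLp.smul_apply, Finset.sum_add_distrib, hsum, smul_eq_mul,
        ← Finset.mul_sum] at h3
      simpa [hε.ne'] using h3
  · rintro ⟨h1, h2, h3⟩
    -- The common coordinate of the barycenter on `s`; as `|u v| ≤ 1`, a step of this size keeps the
    -- coordinates on `s` nonnegative.
    refine ⟨(s.card : ℝ)⁻¹ * (√2)⁻¹, by positivity,
      mem_cell_iff.2 ⟨fun v => ?_, fun v hv => ?_, ?_⟩⟩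
    · by_cases hv : v ∈ s
      · have h : |u v| ≤ 1 := by
          rw [← hu]; exact PiLp.norm_apply_le u v
        have := (abs_le.1 h).1
        simp only [PiLp.add_apply, barycenter_apply, hv, if_true, PiLp.smul_apply, smul_eq_mul]
        have h0 : (0 : ℝ) ≤ (s.card : ℝ)⁻¹ * (√2)⁻¹ := by positivity
        nlinarith
      · have := h1 v hv
        simp only [PiLp.add_apply, barycenter_apply, hv, if_false, PiLp.smul_apply, smul_eq_mul]
        positivity
    · have hvs : v ∉ s := fun h => hv (hst h)
      simp [barycenter_apply, h2 v hv, hvs]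
    · simp only [PiLp.add_apply, PiLp.smul_apply, Finset.sum_add_distrib, hsum, smul_eq_mul,
        ← Finset.mul_sum, h3]
      simp

theorem linkCell_mono {s t t' : Finset V} (h : t ⊆ t') : linkCell s t ⊆ linkCell s t' :=
  fun _ ⟨h1, h2, ε, hε, h3⟩ => ⟨h1, h2, ε, hε, cell_mono h h3⟩

theorem isClosed_linkCell {s t : Finset V} (hs : s.Nonempty) (hst : s ⊆ t) :
    IsClosed (linkCell s t) := by
  have e : linkCell s t = {u : EuclideanSpace ℝ V | ‖u‖ = 1} ∩
      ((⋂ v ∈ s, ⋂ w ∈ s, {u : EuclideanSpace ℝ V | u v = u w}) ∩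
      ((⋂ v ∈ sᶜ, {u : EuclideanSpace ℝ V | 0 ≤ u v}) ∩
      ((⋂ v ∈ tᶜ, {u : EuclideanSpace ℝ V | u v = 0}) ∩
      {u : EuclideanSpace ℝ V | ∑ v, u v = 0}))) := by
    ext u
    simp [mem_linkCell_iff hs hst]
  rw [e]
  refine (isClosed_eq (by fun_prop) (by fun_prop)).inter (.inter ?_ (.inter ?_ (.inter ?_ ?_)))
  · exact isClosed_biInter fun v _ => isClosed_biInter fun w _ =>
      isClosed_eq (by fun_prop) (by fun_prop)
  · exact isClosed_biInter fun v _ => isClosed_le (by fun_prop) (by fun_prop)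
  · exact isClosed_biInter fun v _ => isClosed_eq (by fun_prop) (by fun_prop)
  · exact isClosed_eq (by fun_prop) (by fun_prop)

theorem mem_link {K : PreAbstractSimplicialComplex V} {s : Finset V} {u : EuclideanSpace ℝ V} :
    u ∈ link K s ↔ ∃ t ∈ K, s ⊆ t ∧ u ∈ linkCell s t := by
  simp [link, and_assoc]

theorem mem_realization {K : PreAbstractSimplicialComplex V} {x : EuclideanSpace ℝ V} :
    x ∈ realization K ↔ ∃ s ∈ K, x ∈ cell s := by
  simp [realization]

theorem norm_eq_one_of_mem_link {K : PreAbstractSimplicialComplex V} {s : Finset V}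
    {u : EuclideanSpace ℝ V} (hu : u ∈ link K s) : ‖u‖ = 1 := by
  obtain ⟨t, _, _, h⟩ := mem_link.1 hu
  exact h.1

end Coordinates

/-! ### The intrinsic metric of a link -/

section LinkMetric

variable {V : Type*} [Fintype V] [DecidableEq V] {K : PreAbstractSimplicialComplex V}
  {s t : Finset V} {u v w : EuclideanSpace ℝ V}

/-- A function on strings that satisfies the triangle inequality and is at most the angle on the
cells of the link is at most the intrinsic metric. -/
theorem le_linkEDist (d : EuclideanSpace ℝ V → EuclideanSpace ℝ V → ℝ≥0∞)
    (d_self : ∀ u, u ∈ link K s → d u u = 0)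
    (d_triangle : ∀ u v w, u ∈ link K s → v ∈ link K s → w ∈ link K s → d u w ≤ d u v + d v w)
    (d_le : ∀ t ∈ K, s ⊆ t → ∀ u ∈ linkCell s t, ∀ v ∈ linkCell s t,
      d u v ≤ ENNReal.ofReal (InnerProductGeometry.angle u v))
    (hu : u ∈ link K s) : d u v ≤ linkEDist K s u v := by
  refine le_iInf fun m => le_iInf fun w => le_iInf fun ⟨h0, hm, hw⟩ => ?_
  have key : ∀ k ≤ m, w k ∈ link K s ∧ d u (w k) ≤ ∑ i ∈ Finset.range k,
      ENNReal.ofReal (InnerProductGeometry.angle (w i) (w (i + 1))) := by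
    intro k
    induction k with
    | zero => intro _; rw [h0]; exact ⟨hu, by simp [d_self u hu]⟩
    | succ k ih =>
      intro hk
      obtain ⟨h1, h2⟩ := ih (by omega)
      obtain ⟨t, ht, hst, ha, hb⟩ := hw k (by omega)
      have hb' : w (k + 1) ∈ link K s := mem_link.2 ⟨t, ht, hst, hb⟩
      refine ⟨hb', ?_⟩
      rw [Finset.sum_range_succ]
      exact (d_triangle u (w k) _ hu h1 hb').trans (add_le_add h2 (d_le t ht hst _ ha _ hb))
  rw [← hm]
  exact (key m le_rfl).2

/-- Angles in the ambient sphere satisfy the triangle inequality, so no string can beat the direct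
angle. -/
theorem angle_le_linkEDist (hu : u ∈ link K s) :
    ENNReal.ofReal (InnerProductGeometry.angle u v) ≤ linkEDist K s u v := by
  refine le_linkEDist (fun u v => ENNReal.ofReal (InnerProductGeometry.angle u v)) ?_ ?_ ?_ hu
  · intro u hu
    rw [InnerProductGeometry.angle_self]
    · simp
    · rw [← norm_ne_zero_iff, norm_eq_one_of_mem_link hu]; simp
  · intro u v w _ _ _
    rw [← ENNReal.ofReal_add (InnerProductGeometry.angle_nonneg _ _)
      (InnerProductGeometry.angle_nonneg _ _)]
    exact ENNReal.ofReal_le_ofReal (InnerProductGeometry.angle_le_angle_add_angle _ _ _)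
  · intros; exact le_rfl

theorem linkEDist_le_angle (ht : t ∈ K) (hst : s ⊆ t) (hu : u ∈ linkCell s t)
    (hv : v ∈ linkCell s t) :
    linkEDist K s u v ≤ ENNReal.ofReal (InnerProductGeometry.angle u v) := by
  refine iInf_le_of_le 1 (iInf_le_of_le (fun i => if i = 0 then u else v)
    (iInf_le_of_le ⟨by simp, by simp, ?_⟩ (by simp)))
  intro i hi
  obtain rfl : i = 0 := by omega
  exact ⟨t, ht, hst, by simpa using hu, by simpa using hv⟩

theorem linkEDist_eq_angle (ht : t ∈ K) (hst : s ⊆ t) (hu : u ∈ linkCell s t)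
    (hv : v ∈ linkCell s t) :
    linkEDist K s u v = ENNReal.ofReal (InnerProductGeometry.angle u v) :=
  (linkEDist_le_angle ht hst hu hv).antisymm (angle_le_linkEDist (mem_link.2 ⟨t, ht, hst, hu⟩))

theorem linkEDist_triangle (K : PreAbstractSimplicialComplex V) (s : Finset V)
    (u v w : EuclideanSpace ℝ V) :
    linkEDist K s u w ≤ linkEDist K s u v + linkEDist K s v w := by
  rw [linkEDist, linkEDist, linkEDist]
  simp only [ENNReal.iInf_add, ENNReal.add_iInf]
  refine le_iInf fun m' => le_iInf fun g => le_iInf fun ⟨g0, gm, hg⟩ =>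
    le_iInf fun m => le_iInf fun f => le_iInf fun ⟨f0, fm, hf⟩ => ?_
  have e1 : ∀ i ≤ m, (if i < m then f i else g (i - m)) = f i := by
    intro i hi
    split_ifs with h
    · rfl
    · obtain rfl : i = m := by omega
      simp [g0, fm]
  have e2 : ∀ i, (if m + i < m then f (m + i) else g (m + i - m)) = g i := by
    intro i
    simp
  -- Concatenation of the two strings; at index `m` it takes the value `g 0`, which equals `f m`.
  refine iInf_le_of_le (m + m') (iInf_le_of_le (fun i => if i < m then f i else g (i - m))
    (iInf_le_of_le ⟨(e1 0 (by omega)).trans f0, (e2 m').trans gm, ?_⟩ ?_))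
  · intro i hi
    rcases lt_or_ge i m with h | h
    · have := hf i h
      beta_reduce
      rwa [e1 i h.le, e1 (i + 1) h]
    · obtain ⟨j, rfl⟩ := Nat.exists_eq_add_of_le h
      have := hg j (by omega)
      beta_reduce
      rwa [e2 j, add_assoc, e2 (j + 1)]
  · rw [Finset.sum_range_add]
    refine add_le_add (Finset.sum_le_sum fun i hi => ?_) (Finset.sum_le_sum fun i hi => ?_)
    · have := Finset.mem_range.1 hi
      beta_reduce
      rw [e1 i this.le, e1 (i + 1) this]
    · beta_reduce
      rw [e2 i, add_assoc, e2 (i + 1)]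

end LinkMetric

/-! ### Angles between unit vectors -/

open InnerProductGeometry in
theorem dist_le_angle {E : Type*} [NormedAddCommGroup E] [InnerProductSpace ℝ E] {u v : E}
    (hu : ‖u‖ = 1) (hv : ‖v‖ = 1) : dist u v ≤ angle u v := by
  have h1 : ‖u - v‖ ^ 2 = 2 - 2 * cos (angle u v) := by
    rw [norm_sub_sq_real, cos_angle, hu, hv]; ring
  have h2 := one_sub_sq_div_two_le_cos (x := angle u v)
  rw [dist_eq_norm]
  exact le_of_sq_le_sq (by linarith) (angle_nonneg u v)

open InnerProductGeometry in
/-- Pushing the vertex `p` of an angle at `q` towards `W` decreases the angle, if `W` is closer to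
`q` than to `p`. -/
theorem angle_push_lt {E : Type*} [NormedAddCommGroup E] [InnerProductSpace ℝ E] {p q W : E}
    (hp : ‖p‖ = 1) (hq : ‖q‖ = 1) (hc0 : 0 < cos (angle q p)) (hc1 : cos (angle q p) < 1)
    (hpW : 0 < (inner ℝ p W : ℝ)) (hqW : (inner ℝ p W : ℝ) ≤ inner ℝ q W) :
    angle q (p + (inner ℝ p W * (1 - cos (angle q p)) / ‖W‖ ^ 2) • W) < angle q p := by
  set c := cos (angle q p) with hc
  set f : ℝ := inner ℝ p W with hf
  have hW : 0 < ‖W‖ ^ 2 := by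
    have : W ≠ 0 := by rintro rfl; simp [hf] at hpW
    positivity
  -- This size makes `l * ‖W‖ ^ 2 = f * (1 - c)`, so the quadratic growth of the norm is dominated
  -- by the linear gain in the inner product. The difference of squares compared below is then `l *
  -- f * c * (1 - c) * (2 - c) + l ^ 2 * f ^ 2`.
  set l := f * (1 - c) / ‖W‖ ^ 2 with hl
  have hl0 : 0 < l := div_pos (mul_pos hpW (by linarith)) hW
  have hlW : l * ‖W‖ ^ 2 = f * (1 - c) := by rw [hl, div_mul_cancel₀ _ hW.ne']
  have hn : ‖p + l • W‖ ^ 2 = 1 + 2 * l * f + l ^ 2 * ‖W‖ ^ 2 := by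
    rw [norm_add_sq_real, hp, real_inner_smul_right, norm_smul, mul_pow, Real.norm_eq_abs, sq_abs]
    ring
  have hin : (inner ℝ q (p + l • W) : ℝ) = c + l * inner ℝ q W := by
    rw [inner_add_right, real_inner_smul_right, hc, cos_angle, hp, hq]; simp
  have hpos : 0 < ‖p + l • W‖ ^ 2 := by rw [hn]; positivity
  have hpos' : 0 < ‖p + l • W‖ := by
    rcases (norm_nonneg (p + l • W)).lt_or_eq with h | h
    · exact h
    · rw [← h] at hpos; simp at hpos
  have hlt : c * ‖p + l • W‖ < inner ℝ q (p + l • W) := by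
    rw [hin]
    have h1 : c + l * f ≤ c + l * inner ℝ q W := by gcongr
    refine lt_of_lt_of_le (lt_of_pow_lt_pow_left₀ 2 (by positivity) ?_) h1
    rw [mul_pow, hn]
    have e : l ^ 2 * ‖W‖ ^ 2 = l * (f * (1 - c)) := by rw [← hlW]; ring
    rw [e]
    have h2 : 0 < l * f * c * (1 - c) * (2 - c) := by
      have : 0 < 1 - c := by linarith
      have : 0 < 2 - c := by linarith
      positivity
    have h3 : 0 < l ^ 2 * f ^ 2 := by positivity
    nlinarith
  by_contra! h
  have h2 := cos_le_cos_of_nonneg_of_le_pi (angle_nonneg _ _) (angle_le_pi _ _) h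
  rw [cos_angle (x := q) (y := p + l • W), hq, one_mul, div_le_iff₀ hpos'] at h2
  linarith

/-! ### Links without locally geodesic loops -/

section NoLoops

variable {V : Type*} [Fintype V] [DecidableEq V] {K : PreAbstractSimplicialComplex V}
  {s : Finset V}

/-- There are finitely many cells and they are closed, so a point near `p` avoids every cell that
misses `p`. -/
theorem eventually_mem_common_linkCell (K : PreAbstractSimplicialComplex V) (hs : s.Nonempty)
    (p : EuclideanSpace ℝ V) :
    ∀ᶠ q in nhds p, q ∈ link K s → ∃ t ∈ K, s ⊆ t ∧ p ∈ linkCell s t ∧ q ∈ linkCell s t := by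
  have h : ∀ᶠ q in nhds p, ∀ t : Finset V, s ⊆ t → p ∉ linkCell s t → q ∉ linkCell s t := by
    refine Filter.eventually_all.2 fun t => ?_
    by_cases hst : s ⊆ t
    · by_cases hp : p ∈ linkCell s t
      · simp [hp]
      · filter_upwards [(isClosed_linkCell hs hst).isOpen_compl.mem_nhds hp] with q hq _ _
        exact hq
    · simp [hst]
  filter_upwards [h] with q hq hql
  obtain ⟨t, ht, hst, hqt⟩ := mem_link.1 hql
  exact ⟨t, ht, hst, by_contra fun hp => hq t hst hp hqt, hqt⟩

/-- The vector that points from the barycenter of `s` to `w`. -/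
noncomputable def towards (s : Finset V) (w : V) : EuclideanSpace ℝ V :=
  WithLp.toLp 2 fun x => if x = w then 1 else if x ∈ s then -(s.card : ℝ)⁻¹ else 0

theorem towards_apply (s : Finset V) (w x : V) :
    towards s w x = if x = w then 1 else if x ∈ s then -(s.card : ℝ)⁻¹ else 0 := rfl

theorem sum_towards {w : V} (hw : w ∉ s) (g : V → ℝ) :
    ∑ x, g x * towards s w x = g w - (s.card : ℝ)⁻¹ * ∑ x ∈ s, g x := by
  have e : ∀ x, g x * towards s w x =
      (if x = w then g x else 0) + (if x ∈ s then -(s.card : ℝ)⁻¹ * g x else 0) := by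
    intro x
    rw [towards_apply]
    by_cases h : x = w
    · subst h; simp [hw]
    · by_cases h' : x ∈ s <;> simp [h, h', mul_comm]
  rw [Finset.sum_congr rfl fun x _ => e x, Finset.sum_add_distrib]
  simp [Finset.mul_sum, sub_eq_add_neg]

theorem inner_towards {w : V} (hw : w ∉ s) {u : EuclideanSpace ℝ V} :
    inner ℝ u (towards s w) = u w - (s.card : ℝ)⁻¹ * ∑ x ∈ s, u x := by
  rw [← sum_towards hw, PiLp.inner_apply]
  simp [mul_comm]

/-- A nonzero vector with zero sum, nonnegative off `s` and constant on `s`, must be negative on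
`s`. Hence every point of the link lies within a right angle of the direction of `w`. -/
theorem inner_towards_pos {t : Finset V} (hs : s.Nonempty) (hst : s ⊆ t) {w : V} (hw : w ∉ s)
    {u : EuclideanSpace ℝ V} (hu : u ∈ linkCell s t) : 0 < (inner ℝ u (towards s w) : ℝ) := by
  obtain ⟨h1, h2, h3, h4, h5⟩ := (mem_linkCell_iff hs hst).1 hu
  have hcard : (0 : ℝ) < s.card := by exact_mod_cast hs.card_pos
  have hsplit : ∑ x ∈ s, u x + ∑ x ∈ sᶜ, u x = 0 := by rw [Finset.sum_add_sum_compl, h5]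
  have hnonneg : 0 ≤ ∑ x ∈ sᶜ, u x := Finset.sum_nonneg fun x hx => h3 x (Finset.mem_compl.1 hx)
  have hpos : 0 < ∑ x ∈ sᶜ, u x := by
    refine hnonneg.lt_of_ne fun h => ?_
    have hz := (Finset.sum_eq_zero_iff_of_nonneg
      fun x hx => h3 x (Finset.mem_compl.1 hx)).1 h.symm
    have hu0 : u = 0 := by
      ext x
      by_cases hx : x ∈ s
      · have : ∑ y ∈ s, u y = s.card * u x := by
          rw [Finset.sum_congr rfl fun y hy => h2 y hy x hx]; simp
        rw [← h, add_zero, this] at hsplit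
        simpa [hcard.ne'] using hsplit
      · exact hz x (Finset.mem_compl.2 hx)
    simp [hu0] at h1
  rw [inner_towards hw]
  have := h3 w hw
  have h6 : ∑ x ∈ s, u x < 0 := by linarith
  have := mul_neg_of_pos_of_neg (inv_pos.2 hcard) h6
  linarith

theorem push_mem_linkCell {t : Finset V} (hs : s.Nonempty) (hst : s ⊆ t) {w : V} (hw : w ∉ s)
    (hwt : w ∈ t) {u : EuclideanSpace ℝ V} (hu : u ∈ linkCell s t) {l : ℝ} (hl : 0 ≤ l) :
    ‖u + l • towards s w‖⁻¹ • (u + l • towards s w) ∈ linkCell s t := by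
  have hpos := inner_towards_pos hs hst hw hu
  obtain ⟨h1, h2, h3, h4, h5⟩ := (mem_linkCell_iff hs hst).1 hu
  have hne : u + l • towards s w ≠ 0 := by
    intro h
    have : (inner ℝ (u + l • towards s w) (towards s w) : ℝ) = 0 := by rw [h, inner_zero_left]
    rw [inner_add_left, real_inner_smul_left] at this
    have := mul_nonneg hl (real_inner_self_nonneg (x := towards s w))
    linarith
  have hne' : ‖u + l • towards s w‖ ≠ 0 := norm_ne_zero_iff.2 hne
  refine (mem_linkCell_iff hs hst).2 ⟨?_, fun x hx y hy => ?_, fun x hx => ?_, fun x hx => ?_, ?_⟩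
  · rw [norm_smul, norm_inv, norm_norm, inv_mul_cancel₀ hne']
  · have hxw : x ≠ w := by rintro rfl; exact hw hx
    have hyw : y ≠ w := by rintro rfl; exact hw hy
    simp [towards_apply, hx, hy, hxw, hyw, h2 x hx y hy]
  · have := h3 x hx
    simp only [PiLp.smul_apply, PiLp.add_apply, towards_apply, hx, if_false, smul_eq_mul]
    split_ifs <;> positivity
  · have hxw : x ≠ w := by rintro rfl; exact hx hwt
    have hxs : x ∉ s := fun h => hx (hst h)
    simp [towards_apply, hxw, hxs, h4 x hx]
  · have e := sum_towards hw fun _ => 1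
    have hcard : (s.card : ℝ) ≠ 0 := by exact_mod_cast hs.card_pos.ne'
    simp only [one_mul, Finset.sum_const, nsmul_eq_mul, mul_one, inv_mul_cancel₀ hcard,
      sub_self] at e
    simp only [PiLp.smul_apply, PiLp.add_apply, smul_eq_mul, ← Finset.mul_sum,
      Finset.sum_add_distrib, h5, e]
    simp

namespace IsLocallyGeodesicLoop

variable {ℓ : ℝ} {ρ : AddCircle ℓ → EuclideanSpace ℝ V}

theorem continuous (h : IsLocallyGeodesicLoop K s ℓ ρ) : Continuous ρ := by
  refine Metric.continuous_iff.2 fun x η hη => ?_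
  obtain ⟨ε, hε, hx⟩ := h.isometric x
  refine ⟨min ε η, lt_min hε hη, fun y hy => ?_⟩
  have e := hx y (mem_ball.2 (hy.trans_le (min_le_left _ _))) x (mem_ball_self hε)
  have h1 := angle_le_linkEDist (v := ρ x) (h.mem y)
  rw [e, edist_dist, ENNReal.ofReal_le_ofReal_iff dist_nonneg] at h1
  exact ((dist_le_angle (norm_eq_one_of_mem_link (h.mem y))
    (norm_eq_one_of_mem_link (h.mem x))).trans h1).trans_lt (hy.trans_le (min_le_right _ _))

end IsLocallyGeodesicLoop

/-- If `K` is a cone with apex `w`, the link of a simplex that does not contain `w` has no locally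
geodesic loop: the distance to `w` would be strictly convex along such a loop. -/
theorem not_isLocallyGeodesicLoop_of_cone (hs : s.Nonempty) {w : V} (hw : w ∉ s)
    (hK : ∀ t ∈ K, insert w t ∈ K) {ℓ : ℝ} (ρ : AddCircle ℓ → EuclideanSpace ℝ V) :
    ¬ IsLocallyGeodesicLoop K s ℓ ρ := by
  intro h
  have : Fact (0 < ℓ) := ⟨h.pos⟩
  have hℓ := h.pos
  set W := towards s w with hW
  obtain ⟨x₀, -, hmin⟩ := isCompact_univ.exists_isMinOn univ_nonempty
    (f := fun x => (inner ℝ (ρ x) W : ℝ))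
    (Continuous.inner h.continuous continuous_const).continuousOn
  have hmin' : ∀ x, (inner ℝ (ρ x₀) W : ℝ) ≤ inner ℝ (ρ x) W := fun x => hmin (mem_univ x)
  -- At `x₀` the loop is farthest from the direction of `w`; the contradiction is a shortcut between
  -- the points at distance `δ` on either side.
  obtain ⟨ε, hε, hiso⟩ := h.isometric x₀
  obtain ⟨η, hη, hcommon⟩ := Metric.eventually_nhds_iff.1
    (h.continuous.continuousAt.eventually (eventually_mem_common_linkCell K hs (ρ x₀)))
  -- The bounds serve, in order, the local isometry, the common cell with `ρ x₀`, the equality of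
  -- the circle distance of `x₀ ± δ` with `2δ`, and `cos δ > 0`.
  obtain ⟨δ, hδ0, hδ⟩ : ∃ δ : ℝ, 0 < δ ∧ δ < ε ∧ δ < η ∧ δ ≤ ℓ / 4 ∧ δ ≤ 1 :=
    ⟨min (min (ε / 2) (η / 2)) (min (ℓ / 4) 1), by positivity,
      ((min_le_left _ _).trans (min_le_left _ _)).trans_lt (by linarith),
      ((min_le_left _ _).trans (min_le_right _ _)).trans_lt (by linarith),
      (min_le_right _ _).trans (min_le_left _ _), (min_le_right _ _).trans (min_le_right _ _)⟩
  obtain ⟨hδε, hδη, hδℓ, hδ1⟩ := hδ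
  have hnorm : ∀ c : ℝ, |c| ≤ ℓ / 2 → ‖(c : AddCircle ℓ)‖ = |c| := fun c hc =>
    (AddCircle.norm_coe_eq_abs_iff ℓ hℓ.ne').2 (by rwa [abs_of_pos hℓ])
  have hnormδ : ‖(δ : AddCircle ℓ)‖ = δ := by
    rw [hnorm δ (by rw [abs_of_pos hδ0]; linarith), abs_of_pos hδ0]
  have side : ∀ y : AddCircle ℓ, dist y x₀ = δ → ∃ t ∈ K, s ⊆ t ∧ w ∈ t ∧ ρ x₀ ∈ linkCell s t ∧
      ρ y ∈ linkCell s t ∧ InnerProductGeometry.angle (ρ y) (ρ x₀) = δ := by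
    intro y hy
    obtain ⟨t, ht, hst, h1, h2⟩ := hcommon (y := y) (by rw [hy]; exact hδη) (h.mem y)
    -- Enlarging the common cell by the apex `w` makes room for the push.
    have h1' := linkCell_mono (s := s) (Finset.subset_insert w t) h1
    have h2' := linkCell_mono (s := s) (Finset.subset_insert w t) h2
    have hst' := hst.trans (Finset.subset_insert w t)
    refine ⟨_, hK t ht, hst', Finset.mem_insert_self _ _, h1', h2', ?_⟩
    have e := hiso y (mem_ball.2 (by rw [hy]; exact hδε)) x₀ (mem_ball_self hε)
    rwa [linkEDist_eq_angle (hK t ht) hst' h2' h1', edist_dist, hy, ENNReal.ofReal_eq_ofReal_iff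
      (InnerProductGeometry.angle_nonneg _ _) hδ0.le] at e
  have hcos0 : 0 < cos δ := cos_pos_of_mem_Ioo ⟨by linarith [pi_pos], by linarith [pi_gt_three]⟩
  have hcos1 : cos δ < 1 := by
    have := cos_lt_cos_of_nonneg_of_le_pi le_rfl (by linarith [pi_gt_three]) hδ0
    rwa [cos_zero] at this
  set l := (inner ℝ (ρ x₀) W : ℝ) * (1 - cos δ) / ‖W‖ ^ 2 with hl
  set q := ‖ρ x₀ + l • W‖⁻¹ • (ρ x₀ + l • W) with hq
  have push : ∀ y : AddCircle ℓ, dist y x₀ = δ →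
      InnerProductGeometry.angle (ρ y) q < δ ∧
      ∃ t ∈ K, s ⊆ t ∧ q ∈ linkCell s t ∧ ρ y ∈ linkCell s t := by
    intro y hy
    obtain ⟨t, ht, hst, hwt, h1, h2, h3⟩ := side y hy
    have hfpos := inner_towards_pos hs hst hw h1
    have hl0 : 0 ≤ l := by
      refine div_nonneg (mul_nonneg hfpos.le (by linarith)) (by positivity)
    have hqt : q ∈ linkCell s t := push_mem_linkCell hs hst hw hwt h1 hl0
    refine ⟨?_, t, ht, hst, hqt, h2⟩
    have hpos : 0 < ‖ρ x₀ + l • W‖⁻¹ := by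
      refine (inv_nonneg.2 (norm_nonneg _)).lt_of_ne fun h0 => ?_
      have := hqt.1
      rw [hq, ← h0] at this
      simp at this
    have := angle_push_lt (W := W) h1.1 h2.1 (by rwa [h3]) (by rwa [h3]) hfpos (hmin' y)
    rw [h3] at this
    rwa [hq, InnerProductGeometry.angle_smul_right_of_pos _ _ hpos]
  have d1 : dist (x₀ + (δ : AddCircle ℓ)) x₀ = δ := by simp [hnormδ]
  have d2 : dist (x₀ - (δ : AddCircle ℓ)) x₀ = δ := by simp [hnormδ]
  have d3 : dist (x₀ + (δ : AddCircle ℓ)) (x₀ - (δ : AddCircle ℓ)) = δ + δ := by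
    rw [dist_eq_norm]
    have : x₀ + (δ : AddCircle ℓ) - (x₀ - (δ : AddCircle ℓ)) = ((δ + δ : ℝ) : AddCircle ℓ) := by
      rw [AddCircle.coe_add]; abel
    rw [this, hnorm (δ + δ) (by rw [abs_of_pos (by linarith)]; linarith),
      abs_of_pos (by linarith)]
  obtain ⟨a1, t1, ht1, hst1, hq1, hy1⟩ := push _ d1
  obtain ⟨a2, t2, ht2, hst2, hq2, hy2⟩ := push _ d2
  have e := hiso (x₀ + δ) (mem_ball.2 (by rw [d1]; exact hδε)) (x₀ - δ)
    (mem_ball.2 (by rw [d2]; exact hδε))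
  rw [edist_dist, d3] at e
  -- The detour through the pushed point `q` is shorter than `2δ`, the distance required by the
  -- local isometry.
  have tri := linkEDist_triangle K s (ρ (x₀ + δ)) q (ρ (x₀ - δ))
  rw [e, linkEDist_eq_angle ht1 hst1 hy1 hq1, linkEDist_eq_angle ht2 hst2 hq2 hy2,
    ← ENNReal.ofReal_add (InnerProductGeometry.angle_nonneg _ _)
    (InnerProductGeometry.angle_nonneg _ _), ENNReal.ofReal_le_ofReal_iff (add_nonneg
    (InnerProductGeometry.angle_nonneg _ _) (InnerProductGeometry.angle_nonneg _ _)),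
    InnerProductGeometry.angle_comm q] at tri
  linarith

/-- With at most one vertex `x` off `s`, a vector of the cell is a nonnegative multiple of `towards
s x`, and its norm fixes the multiple. -/
theorem linkCell_subsingleton {t : Finset V} (hs : s.Nonempty) (hst : s ⊆ t)
    (hcard : t.card ≤ s.card + 1) : (linkCell s t).Subsingleton := by
  intro u hu v hv
  obtain ⟨x, hx⟩ : ∃ x, t ⊆ insert x s := by
    have h1 : (t \ s).card ≤ 1 := by rw [Finset.card_sdiff_of_subset hst]; omega
    obtain ⟨y, hy⟩ := hs
    have : Nonempty V := ⟨y⟩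
    rcases Finset.card_le_one_iff_subset_singleton.1 h1 with ⟨x, hx⟩
    refine ⟨x, fun z hz => ?_⟩
    by_cases h : z ∈ s
    · exact Finset.mem_insert_of_mem h
    · rw [Finset.mem_singleton.1 (hx (Finset.mem_sdiff.2 ⟨hz, h⟩))]
      exact Finset.mem_insert_self _ _
  obtain ⟨y, hy⟩ := hs
  have hs : s.Nonempty := ⟨y, hy⟩
  have hcpos : (0 : ℝ) < s.card := by exact_mod_cast hs.card_pos
  have key : ∀ u ∈ linkCell s t, ∃ c : ℝ, 0 ≤ c ∧ u = c • towards s x := by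
    intro u hu
    obtain ⟨h1, h2, h3, h4, h5⟩ := (mem_linkCell_iff hs hst).1 hu
    by_cases hxs : x ∈ s
    -- Here `t = s`, and the cell is empty: constancy on `s` and zero sum force `u = 0`.
    · exfalso
      rw [Finset.insert_eq_self.2 hxs] at hx
      have hz : ∀ z ∉ s, u z = 0 := fun z hz => h4 z fun h => hz (hx h)
      have h6 : (s.card : ℝ) * u y = 0 := by
        rw [← h5, ← Finset.sum_subset (Finset.subset_univ s) fun z _ h => hz z h,
          Finset.sum_congr rfl fun z hz => h2 z hz y hy]
        simp
      have : u = 0 := by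
        ext z
        by_cases hzs : z ∈ s
        · rw [h2 z hzs y hy]; simpa [hcpos.ne'] using h6
        · exact hz z hzs
      simp [this] at h1
    · refine ⟨u x, h3 x hxs, ?_⟩
      have hz : ∀ z ∉ insert x s, u z = 0 := fun z hz => h4 z fun h => hz (hx h)
      have h6 : u x + s.card * u y = 0 := by
        rw [← h5, ← Finset.sum_subset (Finset.subset_univ (insert x s)) fun z _ h => hz z h,
          Finset.sum_insert hxs, Finset.sum_congr rfl fun z hz => h2 z hz y hy]
        simp
      ext z
      rw [PiLp.smul_apply, towards_apply, smul_eq_mul]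
      split_ifs with hzx hzs
      · rw [hzx, mul_one]
      · rw [h2 z hzs y hy]; field_simp; linarith
      · rw [mul_zero]; exact hz z (by simp [hzx, hzs])
  obtain ⟨a, ha, rfl⟩ := key u hu
  obtain ⟨b, hb, rfl⟩ := key v hv
  have e1 := hu.1
  have e2 := hv.1
  rw [norm_smul, Real.norm_of_nonneg ha] at e1
  rw [norm_smul, Real.norm_of_nonneg hb] at e2
  have h0 : ‖towards s x‖ ≠ 0 := by intro h; rw [h] at e1; simp at e1
  rw [mul_right_cancel₀ h0 (e1.trans e2.symm)]

/-- The link of a simplex of codimension at most one is finite and has no locally geodesic loop. -/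
theorem not_isLocallyGeodesicLoop_of_card_le (hs : s.Nonempty)
    (hK : ∀ t ∈ K, s ⊆ t → t.card ≤ s.card + 1) {ℓ : ℝ} (ρ : AddCircle ℓ → EuclideanSpace ℝ V) :
    ¬ IsLocallyGeodesicLoop K s ℓ ρ := by
  intro h
  have : Fact (0 < ℓ) := ⟨h.pos⟩
  have hfin : (link K s).Finite :=
    Set.Finite.biUnion (Set.toFinite _) fun t ht =>
      (linkCell_subsingleton hs ht.2 (hK t ht.1 ht.2)).finite
  have hinf : Infinite (AddCircle ℓ) :=
    have : Infinite (Ico (0 : ℝ) (0 + ℓ)) := (Ico_infinite (by simpa using h.pos)).to_subtype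
    Infinite.of_injective _ (AddCircle.equivIco ℓ 0).symm.injective
  exact (Set.infinite_of_injective_forall_mem h.injective h.mem) hfin

end NoLoops

/-! ### Arcs of great circles -/

section Arc

variable {E : Type*} [NormedAddCommGroup E] [InnerProductSpace ℝ E]

/-- The arc of a great circle from `x` to `y`, two unit vectors at angle `a`. -/
noncomputable def arc (a : ℝ) (x y : E) (u : ℝ) : E :=
  (sin (a - u) / sin a) • x + (sin u / sin a) • y

variable {a : ℝ} {x y : E}

theorem arc_zero (ha : sin a ≠ 0) : arc a x y 0 = x := by
  simp [arc, ha]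

theorem arc_end (ha : sin a ≠ 0) : arc a x y a = y := by
  simp [arc, ha]

theorem inner_arc (ha : sin a ≠ 0) (hx : ‖x‖ = 1) (hy : ‖y‖ = 1)
    (hxy : (inner ℝ x y : ℝ) = cos a) (u v : ℝ) :
    (inner ℝ (arc a x y u) (arc a x y v) : ℝ) = cos (u - v) := by
  have hyx : (inner ℝ y x : ℝ) = cos a := by rw [real_inner_comm, hxy]
  simp only [arc, inner_add_left, inner_add_right, real_inner_smul_left, real_inner_smul_right,
    hxy, hyx, real_inner_self_eq_norm_sq, hx, hy, sin_sub, cos_sub]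
  field_simp
  have h1 := sin_sq_add_cos_sq a
  have h2 : sin a ^ 2 = 1 - cos a ^ 2 := by linarith
  ring_nf
  rw [h2]
  ring

theorem norm_arc (ha : sin a ≠ 0) (hx : ‖x‖ = 1) (hy : ‖y‖ = 1)
    (hxy : (inner ℝ x y : ℝ) = cos a) (u : ℝ) : ‖arc a x y u‖ = 1 := by
  have h := inner_arc ha hx hy hxy u u
  rw [sub_self, cos_zero, real_inner_self_eq_norm_sq] at h
  exact (pow_eq_one_iff_of_nonneg (norm_nonneg _) two_ne_zero).1 h

theorem angle_arc (ha : sin a ≠ 0) (hx : ‖x‖ = 1) (hy : ‖y‖ = 1)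
    (hxy : (inner ℝ x y : ℝ) = cos a) {u v : ℝ} (huv : |u - v| ≤ π) :
    InnerProductGeometry.angle (arc a x y u) (arc a x y v) = |u - v| := by
  rw [InnerProductGeometry.angle, inner_arc ha hx hy hxy, norm_arc ha hx hy hxy,
    norm_arc ha hx hy hxy, mul_one, div_one, ← cos_abs, arccos_cos (abs_nonneg _) huv]

/-- The parameter is the angle to `x`, whose cosine is `c = α + β * cos a`. The norm condition gives
it the sine `β * sin a`, and then `sin (a - u) = α * sin a ≥ 0` rules out `u > a`. -/
theorem exists_eq_arc (ha0 : 0 < a) (haπ : a < π) (hx : ‖x‖ = 1) (hy : ‖y‖ = 1)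
    (hxy : (inner ℝ x y : ℝ) = cos a) {α β : ℝ} (hα : 0 ≤ α) (hβ : 0 ≤ β)
    (h : ‖α • x + β • y‖ = 1) : ∃ u ∈ Icc 0 a, α • x + β • y = arc a x y u := by
  have hsin : 0 < sin a := sin_pos_of_pos_of_lt_pi ha0 haπ
  have h2 : α ^ 2 + 2 * (α * β * cos a) + β ^ 2 = 1 := by
    have := norm_add_sq_real (α • x) (β • y)
    rw [h, real_inner_smul_left, real_inner_smul_right, hxy, norm_smul, norm_smul, hx, hy,
      Real.norm_of_nonneg hα, Real.norm_of_nonneg hβ] at this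
    linarith
  have hs := sin_sq_add_cos_sq a
  set c := α + β * cos a with hc
  have hc2 : 1 - c ^ 2 = (β * sin a) ^ 2 := by
    have : sin a ^ 2 = 1 - cos a ^ 2 := by linarith
    rw [mul_pow, this, hc]; linear_combination -h2
  have hc1 : c ^ 2 ≤ 1 := by nlinarith [sq_nonneg (β * sin a)]
  obtain ⟨hcl, hcu⟩ := abs_le.1 ((sq_le_one_iff_abs_le_one c).1 hc1)
  have e1 : cos (arccos c) = c := cos_arccos hcl hcu
  have e2 : sin (arccos c) = β * sin a := by
    rw [sin_arccos, hc2, sqrt_sq (by positivity)]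
  have e3 : sin (a - arccos c) = α * sin a := by
    rw [sin_sub, e1, e2, hc]; ring
  refine ⟨arccos c, ⟨arccos_nonneg c, ?_⟩, ?_⟩
  · by_contra! hlt
    have : sin (a - arccos c) < 0 :=
      sin_neg_of_neg_of_neg_pi_lt (by linarith) (by linarith [arccos_le_pi c])
    rw [e3] at this
    exact absurd this (not_lt.2 (by positivity))
  · rw [arc, e2, e3, mul_div_cancel_right₀ _ hsin.ne', mul_div_cancel_right₀ _ hsin.ne']

end Arc

/-! ### Vertices and edges of one-dimensional links -/

section Direction

variable {V : Type*} [Fintype V] [DecidableEq V] {s t : Finset V} {v w : V}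

theorem inner_towards_towards (hs : s.Nonempty) (hv : v ∉ s) (hw : w ∉ s) :
    (inner ℝ (towards s v) (towards s w) : ℝ) = (if v = w then 1 else 0) + (s.card : ℝ)⁻¹ := by
  have hcard : (s.card : ℝ) ≠ 0 := by exact_mod_cast hs.card_pos.ne'
  have e : ∀ x ∈ s, towards s v x = -(s.card : ℝ)⁻¹ := by
    intro x hx
    rw [towards_apply, if_neg (by rintro rfl; exact hv hx), if_pos hx]
  rw [inner_towards hw, Finset.sum_congr rfl e, towards_apply, if_neg hw]
  simp only [Finset.sum_const, nsmul_eq_mul]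
  field_simp
  simp [eq_comm]

/-- The vertex of the link of `s` in the direction of `w`. -/
noncomputable def direction (s : Finset V) (w : V) : EuclideanSpace ℝ V :=
  (√(1 + (s.card : ℝ)⁻¹))⁻¹ • towards s w

/-- Source of both edge lengths: `card s = n - 1` gives `arccos (1 / n)` and `card s = 1` gives `π /
3`. -/
theorem inner_direction (hs : s.Nonempty) (hv : v ∉ s) (hw : w ∉ s) (hvw : v ≠ w) :
    (inner ℝ (direction s v) (direction s w) : ℝ) = 1 / (s.card + 1) := by
  have hcard : (0 : ℝ) < s.card := by exact_mod_cast hs.card_pos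
  rw [direction, direction, real_inner_smul_left, real_inner_smul_right,
    inner_towards_towards hs hv hw, if_neg hvw, ← mul_assoc, ← mul_inv,
    mul_self_sqrt (by positivity)]
  field_simp
  ring

theorem norm_direction (hs : s.Nonempty) (hw : w ∉ s) : ‖direction s w‖ = 1 := by
  refine (pow_eq_one_iff_of_nonneg (norm_nonneg _) two_ne_zero).1 ?_
  rw [← real_inner_self_eq_norm_sq, direction, real_inner_smul_left, real_inner_smul_right,
    inner_towards_towards hs hw hw, if_pos rfl, ← mul_assoc, ← mul_inv,
    mul_self_sqrt (by positivity), inv_mul_cancel₀ (by positivity)]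

theorem direction_apply_self : direction s w w = (√(1 + (s.card : ℝ)⁻¹))⁻¹ := by
  simp [direction, towards_apply]

theorem direction_apply_of_ne (hv : v ∉ s) (hvw : v ≠ w) : direction s w v = 0 := by
  simp [direction, towards_apply, hv, hvw]

/-- A point in the link of `s` in `s ∪ {v, w}` is a nonnegative combination of the directions. -/
theorem exists_combination (hs : s.Nonempty) (hv : v ∉ s) (hw : w ∉ s) (hvw : v ≠ w)
    {u : EuclideanSpace ℝ V} (hu : u ∈ linkCell s (s ∪ {v, w})) :
    ∃ α β : ℝ, 0 ≤ α ∧ 0 ≤ β ∧ u = α • direction s v + β • direction s w := by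
  obtain ⟨h1, h2, h3, h4, h5⟩ := (mem_linkCell_iff hs Finset.subset_union_left).1 hu
  have hcard : (0 : ℝ) < s.card := by exact_mod_cast hs.card_pos
  have hN : √(1 + (s.card : ℝ)⁻¹) ≠ 0 := by positivity
  refine ⟨u v * √(1 + (s.card : ℝ)⁻¹), u w * √(1 + (s.card : ℝ)⁻¹),
    mul_nonneg (h3 v hv) (sqrt_nonneg _), mul_nonneg (h3 w hw) (sqrt_nonneg _), ?_⟩
  rw [direction, direction, smul_smul, smul_smul, mul_assoc, mul_assoc, mul_inv_cancel₀ hN,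
    mul_one, mul_one]
  ext z
  simp only [PiLp.add_apply, PiLp.smul_apply, towards_apply, smul_eq_mul]
  by_cases hzs : z ∈ s
  · have hzv : z ≠ v := by rintro rfl; exact hv hzs
    have hzw : z ≠ w := by rintro rfl; exact hw hzs
    simp only [hzv, hzw, hzs, if_true, if_false]
    have h6 : s.card * u z + (u v + u w) = 0 := by
      rw [← h5, ← Finset.sum_subset (Finset.subset_univ (s ∪ {v, w})) fun x _ h => h4 x h,
        Finset.sum_union (by simp [hv, hw]), Finset.sum_pair hvw,
        Finset.sum_congr rfl fun y hy => h2 y hy z hzs]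
      simp
    field_simp
    linarith
  · by_cases hzv : z = v
    · subst hzv; simp [hvw, hzs]
    · by_cases hzw : z = w
      · subst hzw; simp [hvw.symm, hzs]
      · simp [hzv, hzw, hzs, h4 z (by simp [hzv, hzw, hzs])]

theorem direction_mem_linkCell (hs : s.Nonempty) (hst : s ⊆ t) (hw : w ∉ s) (hwt : w ∈ t) :
    direction s w ∈ linkCell s t := by
  refine (mem_linkCell_iff hs hst).2 ⟨norm_direction hs hw, fun x hx y hy => ?_, fun x hx => ?_,
    fun x hx => ?_, ?_⟩
  · have hxw : x ≠ w := by rintro rfl; exact hw hx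
    have hyw : y ≠ w := by rintro rfl; exact hw hy
    simp [direction, towards_apply, hx, hy, hxw, hyw]
  · by_cases h : x = w
    · subst h; rw [direction_apply_self]; positivity
    · rw [direction_apply_of_ne hx h]
  · rw [direction_apply_of_ne (fun h => hx (hst h))]; rintro rfl; exact hx hwt
  · have hcard : (s.card : ℝ) ≠ 0 := by exact_mod_cast hs.card_pos.ne'
    have e := sum_towards hw fun _ => 1
    simp only [one_mul, Finset.sum_const, nsmul_eq_mul, mul_one, inv_mul_cancel₀ hcard,
      sub_self] at e
    simp only [direction, PiLp.smul_apply, smul_eq_mul, ← Finset.mul_sum, e, mul_zero]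

theorem combination_mem_linkCell (hs : s.Nonempty) (hst : s ⊆ t) {u v : EuclideanSpace ℝ V}
    (hu : u ∈ linkCell s t) (hv : v ∈ linkCell s t) {α β : ℝ} (hα : 0 ≤ α) (hβ : 0 ≤ β)
    (h : ‖α • u + β • v‖ = 1) : α • u + β • v ∈ linkCell s t := by
  obtain ⟨-, h2, h3, h4, h5⟩ := (mem_linkCell_iff hs hst).1 hu
  obtain ⟨-, g2, g3, g4, g5⟩ := (mem_linkCell_iff hs hst).1 hv
  refine (mem_linkCell_iff hs hst).2 ⟨h, fun x hx y hy => ?_, fun x hx => ?_, fun x hx => ?_, ?_⟩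
  · simp [h2 x hx y hy, g2 x hx y hy]
  · have := h3 x hx
    have := g3 x hx
    simp only [PiLp.add_apply, PiLp.smul_apply, smul_eq_mul]
    positivity
  · simp [h4 x hx, g4 x hx]
  · simp [Finset.sum_add_distrib, ← Finset.mul_sum, h5, g5]

/-- The length of the edges of a one-dimensional link. -/
noncomputable def edgeAngle (s : Finset V) : ℝ := arccos (1 / (s.card + 1))

theorem cos_edgeAngle (s : Finset V) : cos (edgeAngle s) = 1 / (s.card + 1) := by
  have : (0 : ℝ) < s.card + 1 := by positivity
  refine cos_arccos (by linarith [one_div_pos.2 this]) ?_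
  rw [div_le_one this]
  simp

theorem edgeAngle_pos (hs : s.Nonempty) : 0 < edgeAngle s := by
  have hcard : (0 : ℝ) < s.card := by exact_mod_cast hs.card_pos
  refine arccos_pos.2 ?_
  rw [div_lt_one (by positivity)]
  linarith

theorem edgeAngle_lt (s : Finset V) : edgeAngle s < π / 2 := arccos_lt_pi_div_two.2 (by positivity)

theorem sin_edgeAngle_pos (hs : s.Nonempty) : 0 < sin (edgeAngle s) :=
  sin_pos_of_pos_of_lt_pi (edgeAngle_pos hs) (by linarith [edgeAngle_lt s, pi_pos])

theorem linkCell_edge (hs : s.Nonempty) (hv : v ∉ s) (hw : w ∉ s) (hvw : v ≠ w) :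
    linkCell s (s ∪ {v, w}) =
      arc (edgeAngle s) (direction s v) (direction s w) '' Icc 0 (edgeAngle s) := by
  have hd : (inner ℝ (direction s v) (direction s w) : ℝ) = cos (edgeAngle s) := by
    rw [inner_direction hs hv hw hvw, cos_edgeAngle]
  have hlt := edgeAngle_lt s
  ext u
  constructor
  · intro hu
    obtain ⟨α, β, hα, hβ, rfl⟩ := exists_combination hs hv hw hvw hu
    obtain ⟨r, hr, e⟩ := exists_eq_arc (edgeAngle_pos hs) (by linarith [pi_pos])
      (norm_direction hs hv) (norm_direction hs hw) hd hα hβ hu.1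
    exact ⟨r, hr, e.symm⟩
  · rintro ⟨r, ⟨hr0, hr1⟩, rfl⟩
    have hsin := sin_edgeAngle_pos hs
    refine combination_mem_linkCell hs Finset.subset_union_left
      (direction_mem_linkCell hs Finset.subset_union_left hv (by simp))
      (direction_mem_linkCell hs Finset.subset_union_left hw (by simp))
      (div_nonneg (sin_nonneg_of_nonneg_of_le_pi (by linarith) (by linarith [pi_pos])) hsin.le)
      (div_nonneg (sin_nonneg_of_nonneg_of_le_pi (by linarith) (by linarith [pi_pos])) hsin.le)
      (norm_arc hsin.ne' (norm_direction hs hv) (norm_direction hs hw) hd r)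

theorem linkCell_vertex (hs : s.Nonempty) (hw : w ∉ s) :
    linkCell s (s ∪ {w}) = {direction s w} :=
  (linkCell_subsingleton hs Finset.subset_union_left
    (by simpa using Finset.card_union_le s {w})).eq_singleton_of_mem
    (direction_mem_linkCell hs Finset.subset_union_left hw (by simp))

end Direction

theorem AddCircle.norm_coe_le_abs (ℓ x : ℝ) : ‖(x : AddCircle ℓ)‖ ≤ |x| :=
  QuotientAddGroup.norm_mk_le_norm

/-- Rounding picks the representative nearest to zero. -/
theorem AddCircle.exists_coe_eq_norm (ℓ : ℝ) (x : AddCircle ℓ) :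
    ∃ c : ℝ, (c : AddCircle ℓ) = x ∧ |c| = ‖x‖ := by
  obtain ⟨c, rfl⟩ := QuotientAddGroup.mk_surjective x
  refine ⟨c - round (ℓ⁻¹ * c) * ℓ, ?_, (AddCircle.norm_eq ℓ).symm⟩
  rw [AddCircle.coe_sub, sub_eq_self, AddCircle.coe_eq_zero_iff]
  exact ⟨round (ℓ⁻¹ * c), by simp⟩

/-! ### The link at the centre of a cyclic complex is a circle -/

section CyclicLink

variable {V : Type*} [Fintype V] [DecidableEq V] {K : PreAbstractSimplicialComplex V}
  {s : Finset V} {p : ZMod 5 → V}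

/-- The unit speed path that runs around the link of `s` in the cyclic complex with the maximal
simplices `s ∪ {p i, p (i + 1)}`. -/
noncomputable def cyclePath (s : Finset V) (p : ZMod 5 → V) (x : ℝ) : EuclideanSpace ℝ V :=
  arc (edgeAngle s) (direction s (p ⌊x / edgeAngle s⌋)) (direction s (p (⌊x / edgeAngle s⌋ + 1)))
    (x - ⌊x / edgeAngle s⌋ * edgeAngle s)

theorem floor_remainder_mem {a : ℝ} (ha : 0 < a) (x : ℝ) : x - ⌊x / a⌋ * a ∈ Ico 0 a := by
  have h1 := Int.floor_le (x / a)
  have h2 := Int.lt_floor_add_one (x / a)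
  rw [le_div_iff₀ ha] at h1
  rw [div_lt_iff₀ ha] at h2
  exact ⟨by linarith, by linarith⟩

theorem cyclePath_eq_arc (hs : s.Nonempty) (i : ℤ) {x : ℝ}
    (hx : x ∈ Icc (i * edgeAngle s) ((i + 1) * edgeAngle s)) :
    cyclePath s p x = arc (edgeAngle s) (direction s (p i)) (direction s (p (i + 1)))
      (x - i * edgeAngle s) := by
  have ha := edgeAngle_pos hs
  have hsin := (sin_edgeAngle_pos hs).ne'
  rcases hx.2.lt_or_eq with h | h
  · have : ⌊x / edgeAngle s⌋ = i := by
      rw [Int.floor_eq_iff, le_div_iff₀ ha, div_lt_iff₀ ha]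
      exact ⟨hx.1, h⟩
    rw [cyclePath, this]
  -- At the right end the floor has already jumped, but both arcs pass through the direction of `p
  -- (i + 1)`.
  · have : ⌊x / edgeAngle s⌋ = i + 1 := by
      rw [Int.floor_eq_iff, le_div_iff₀ ha, div_lt_iff₀ ha, h]
      push_cast
      exact ⟨le_rfl, by linarith⟩
    have e1 : x - ((i + 1 : ℤ) : ℝ) * edgeAngle s = 0 := by rw [h]; push_cast; ring
    have e2 : x - (i : ℝ) * edgeAngle s = edgeAngle s := by rw [h]; ring
    rw [cyclePath, this, e1, e2, arc_zero hsin, arc_end hsin]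
    push_cast
    rfl

theorem cyclePath_periodic (hs : s.Nonempty) :
    Function.Periodic (cyclePath s p) ((5 : ℕ) * edgeAngle s) := by
  intro x
  have ha := (edgeAngle_pos hs).ne'
  have : ⌊(x + (5 : ℕ) * edgeAngle s) / edgeAngle s⌋ = ⌊x / edgeAngle s⌋ + 5 := by
    rw [add_div, mul_div_cancel_right₀ _ ha, Int.floor_add_natCast]; rfl
  have h5 : ((⌊x / edgeAngle s⌋ + 5 : ℤ) : ZMod 5) = ⌊x / edgeAngle s⌋ := by
    push_cast
    have : (5 : ZMod 5) = 0 := rfl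
    rw [this, add_zero]
  rw [cyclePath, cyclePath, this, h5]
  congr 1
  push_cast
  ring

/-- The circle that parametrizes the link of `s` in the cyclic complex with the maximal simplices
`s ∪ {p i, p (i + 1)}`. -/
noncomputable def cycleMap (hs : s.Nonempty) (p : ZMod 5 → V) :
    AddCircle ((5 : ℕ) * edgeAngle s) → EuclideanSpace ℝ V :=
  (cyclePath_periodic (p := p) hs).lift

theorem cycleMap_coe (hs : s.Nonempty) (x : ℝ) :
    cycleMap hs p (x : AddCircle ((5 : ℕ) * edgeAngle s)) = cyclePath s p x :=
  Function.Periodic.lift_coe _ _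

variable (hs : s.Nonempty) (hp : Function.Injective p) (hps : ∀ i, p i ∉ s)

include hs hp hps

theorem arc_direction_apply (i k : ZMod 5) (u : ℝ) :
    arc (edgeAngle s) (direction s (p i)) (direction s (p (i + 1))) u (p k) =
      ((if k = i then sin (edgeAngle s - u) else 0) + (if k = i + 1 then sin u else 0)) /
        (sin (edgeAngle s) * √(1 + (s.card : ℝ)⁻¹)) := by
  have e : ∀ j, direction s (p j) (p k) = if k = j then (√(1 + (s.card : ℝ)⁻¹))⁻¹ else 0 := by
    intro j
    split_ifs with h
    · rw [h, direction_apply_self]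
    · exact direction_apply_of_ne (hps k) fun h' => h (hp h')
  simp only [arc, PiLp.add_apply, PiLp.smul_apply, e, smul_eq_mul, add_div]
  congr 1 <;> split_ifs <;> first | (field_simp; done) | simp

/-- The coordinates at the vertices `p k` recover the edge and the position on it. With the
remainder in `[0, a)`, the coordinate at the initial vertex is a positive multiple of `sin (a - u)`.
Were the edges different, each initial vertex would have to be the end of the other edge, which a
5-cycle forbids. -/
theorem coe_eq_of_cyclePath_eq {x y : ℝ} (h : cyclePath s p x = cyclePath s p y) :
    (x : AddCircle ((5 : ℕ) * edgeAngle s)) = y := by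
  have ha := edgeAngle_pos hs
  have hsin := sin_edgeAngle_pos hs
  have haπ := edgeAngle_lt s
  obtain ⟨hu0, hu1⟩ := floor_remainder_mem ha x
  obtain ⟨hv0, hv1⟩ := floor_remainder_mem ha y
  set a := edgeAngle s
  set i := ⌊x / a⌋
  set j := ⌊y / a⌋
  set u := x - i * a with hu
  set v := y - j * a with hv
  have hcard : (0 : ℝ) < s.card := by exact_mod_cast hs.card_pos
  have key : ∀ k : ZMod 5,
      (if k = i then sin (a - u) else 0) + (if k = i + 1 then sin u else 0) =
      (if k = j then sin (a - v) else 0) + (if k = j + 1 then sin v else 0) := by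
    intro k
    have := congrArg (fun z : EuclideanSpace ℝ V => z (p k)) h
    simp only [cyclePath, arc_direction_apply hs hp hps] at this
    rwa [div_left_inj' (by positivity)] at this
  have hz : ∀ z : ZMod 5, z ≠ z + 1 ∧ z ≠ z + 1 + 1 := by decide
  have hpu : 0 < sin (a - u) := sin_pos_of_pos_of_lt_pi (by linarith) (by linarith [pi_pos])
  have hpv : 0 < sin (a - v) := sin_pos_of_pos_of_lt_pi (by linarith) (by linarith [pi_pos])
  have hij : (i : ZMod 5) = j := by
    by_contra hne
    have k1 := key i
    rw [if_pos rfl, if_neg (hz _).1, if_neg hne, zero_add, add_zero] at k1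
    have hij1 : (i : ZMod 5) = j + 1 := by
      by_contra hne'
      rw [if_neg hne'] at k1
      exact hpu.ne' k1
    have k2 := key j
    rw [if_pos rfl, if_neg (hz _).1, if_neg (Ne.symm hne), hij1, if_neg (hz _).2] at k2
    linarith
  have huv : u = v := by
    have k1 := key (i + 1)
    rw [← hij, if_neg (hz _).1.symm, if_neg (hz _).1.symm, if_pos rfl, if_pos rfl, zero_add,
      zero_add] at k1
    exact injOn_sin ⟨by linarith [pi_pos], by linarith⟩ ⟨by linarith [pi_pos], by linarith⟩ k1
  obtain ⟨c, hc⟩ := (ZMod.intCast_eq_intCast_iff_dvd_sub i j 5).1 hij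
  rw [eq_comm, ← sub_eq_zero, ← AddCircle.coe_sub, AddCircle.coe_eq_zero_iff]
  refine ⟨c, ?_⟩
  have hc' : (j : ℝ) - i = 5 * c := by exact_mod_cast hc
  rw [zsmul_eq_mul]
  push_cast
  linear_combination -a * hc' + huv

theorem cycleMap_injective : Function.Injective (cycleMap hs p) := by
  intro x y h
  obtain ⟨x, rfl⟩ := QuotientAddGroup.mk_surjective x
  obtain ⟨y, rfl⟩ := QuotientAddGroup.mk_surjective y
  exact coe_eq_of_cyclePath_eq hs hp hps (by rwa [← cycleMap_coe hs, ← cycleMap_coe hs])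

theorem cyclePath_image_Icc (i : ℤ) :
    cyclePath s p '' Icc (i * edgeAngle s) ((i + 1) * edgeAngle s) =
      linkCell s (s ∪ {p i, p (i + 1)}) := by
  have hi : ∀ z : ZMod 5, z ≠ z + 1 := by decide
  rw [linkCell_edge hs (hps _) (hps _) fun h => hi _ (hp h)]
  ext u
  constructor
  · rintro ⟨x, hx, rfl⟩
    exact ⟨x - i * edgeAngle s, ⟨by linarith [hx.1], by linarith [hx.2]⟩,
      (cyclePath_eq_arc hs i hx).symm⟩
  · rintro ⟨r, ⟨hr0, hr1⟩, rfl⟩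
    have hx : i * edgeAngle s + r ∈ Icc (i * edgeAngle s) ((i + 1) * edgeAngle s) :=
      ⟨by linarith, by linarith⟩
    exact ⟨_, hx, by rw [cyclePath_eq_arc hs i hx, add_sub_cancel_left]⟩

theorem angle_cyclePath (i : ℤ) {x y : ℝ}
    (hx : x ∈ Icc (i * edgeAngle s) ((i + 1) * edgeAngle s))
    (hy : y ∈ Icc (i * edgeAngle s) ((i + 1) * edgeAngle s)) :
    InnerProductGeometry.angle (cyclePath s p x) (cyclePath s p y) = |x - y| := by
  have hi : ∀ z : ZMod 5, z ≠ z + 1 := by decide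
  have hlt := edgeAngle_lt s
  rw [cyclePath_eq_arc hs i hx, cyclePath_eq_arc hs i hy, angle_arc (sin_edgeAngle_pos hs).ne'
    (norm_direction hs (hps _)) (norm_direction hs (hps _))
    (by rw [inner_direction hs (hps _) (hps _) fun h => hi _ (hp h), cos_edgeAngle])]
  · congr 1; ring
  · rw [abs_le]
    constructor <;> linarith [hx.1, hx.2, hy.1, hy.2, pi_pos]

variable (hK : ∀ r, s ⊆ r → (r ∈ K ↔ ∃ i, r ⊆ s ∪ {p i, p (i + 1)}))

include hK

/-- Cut the path at the multiples of the edge length and add up angles within cells. Both orders of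
the end points are carried through the induction, in place of symmetry of `linkEDist`. -/
theorem linkEDist_cyclePath_le {x y : ℝ} (hxy : x ≤ y) :
    linkEDist K s (cyclePath s p x) (cyclePath s p y) ≤ ENNReal.ofReal (y - x) ∧
    linkEDist K s (cyclePath s p y) (cyclePath s p x) ≤ ENNReal.ofReal (y - x) := by
  have ha := edgeAngle_pos hs
  have same : ∀ (i : ℤ) {x y : ℝ}, x ≤ y →
      x ∈ Icc (i * edgeAngle s) ((i + 1) * edgeAngle s) →
      y ∈ Icc (i * edgeAngle s) ((i + 1) * edgeAngle s) →
      linkEDist K s (cyclePath s p x) (cyclePath s p y) ≤ ENNReal.ofReal (y - x) ∧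
      linkEDist K s (cyclePath s p y) (cyclePath s p x) ≤ ENNReal.ofReal (y - x) := by
    intro i x y hxy hx hy
    have hx' := cyclePath_image_Icc hs hp hps i ▸ mem_image_of_mem (cyclePath s p) hx
    have hy' := cyclePath_image_Icc hs hp hps i ▸ mem_image_of_mem (cyclePath s p) hy
    have hT : s ∪ {p i, p (i + 1)} ∈ K := (hK _ Finset.subset_union_left).2 ⟨i, subset_rfl⟩
    rw [linkEDist_eq_angle hT Finset.subset_union_left hx' hy',
      linkEDist_eq_angle hT Finset.subset_union_left hy' hx', angle_cyclePath hs hp hps i hx hy,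
      angle_cyclePath hs hp hps i hy hx, abs_sub_comm, abs_of_nonneg (sub_nonneg.2 hxy)]
    exact ⟨le_rfl, le_rfl⟩
  have hfl := floor_remainder_mem ha x
  set i := ⌊x / edgeAngle s⌋
  -- `k` bounds the number of edge boundaries strictly between `x` and `y`.
  have main : ∀ (k : ℕ) (y : ℝ), x ≤ y → y ≤ (i + k + 1) * edgeAngle s →
      linkEDist K s (cyclePath s p x) (cyclePath s p y) ≤ ENNReal.ofReal (y - x) ∧
      linkEDist K s (cyclePath s p y) (cyclePath s p x) ≤ ENNReal.ofReal (y - x) := by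
    intro k
    induction k with
    | zero =>
      intro y hxy hy
      simp only [Nat.cast_zero, add_zero] at hy
      exact same i hxy ⟨by linarith [hfl.1], by linarith [hfl.2]⟩ ⟨by linarith [hfl.1], hy⟩
    | succ k ih =>
      intro y hxy hy
      rcases le_total y ((i + k + 1) * edgeAngle s) with h | h
      · exact ih y hxy h
      · have hz : x ≤ (i + k + 1) * edgeAngle s := by
          have := hfl.2
          nlinarith [(Nat.cast_nonneg k : (0 : ℝ) ≤ k)]
        obtain ⟨h1, h2⟩ := ih _ hz le_rfl
        obtain ⟨h3, h4⟩ := same (i + k + 1) h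
          ⟨by push_cast; exact le_rfl, by push_cast; linarith⟩
          ⟨by push_cast; exact h, by push_cast at hy ⊢; linarith⟩
        have e : ENNReal.ofReal (y - x) = ENNReal.ofReal ((i + k + 1) * edgeAngle s - x) +
            ENNReal.ofReal (y - (i + k + 1) * edgeAngle s) := by
          rw [← ENNReal.ofReal_add (by linarith) (by linarith)]; congr 1; ring
        rw [e]
        refine ⟨(linkEDist_triangle K s _ _ _).trans (add_le_add h1 h3),
          (linkEDist_triangle K s _ (cyclePath s p ((i + k + 1) * edgeAngle s)) _).trans ?_⟩
        rw [add_comm (ENNReal.ofReal _)]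
        exact add_le_add h4 h2
  obtain ⟨k, hk⟩ := exists_nat_ge (y / edgeAngle s - i - 1)
  refine main k y hxy ?_
  rw [← div_le_iff₀ ha]
  linarith

theorem exists_linkCell_subset {t : Finset V} (ht : t ∈ K) (hst : s ⊆ t) :
    ∃ i : ℤ, linkCell s t ⊆
      cyclePath s p '' Icc (i * edgeAngle s) ((i + 1) * edgeAngle s) := by
  obtain ⟨i, hi⟩ := (hK t hst).1 ht
  obtain ⟨i, rfl⟩ := ZMod.intCast_surjective i
  exact ⟨i, by rw [cyclePath_image_Icc hs hp hps]; exact linkCell_mono hi⟩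

theorem range_cycleMap : range (cycleMap hs p) = link K s := by
  ext u
  constructor
  · rintro ⟨x, rfl⟩
    obtain ⟨x, rfl⟩ := QuotientAddGroup.mk_surjective x
    obtain ⟨h0, h1⟩ := floor_remainder_mem (edgeAngle_pos hs) x
    set i := ⌊x / edgeAngle s⌋
    refine mem_link.2 ⟨s ∪ {p i, p (i + 1)}, (hK _ Finset.subset_union_left).2 ⟨i, subset_rfl⟩,
      Finset.subset_union_left, ?_⟩
    rw [← cyclePath_image_Icc hs hp hps i]
    exact ⟨x, ⟨by linarith, by linarith⟩, (cycleMap_coe hs x).symm⟩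
  · intro hu
    obtain ⟨t, ht, hst, hu⟩ := mem_link.1 hu
    obtain ⟨i, hi⟩ := exists_linkCell_subset hs hp hps hK ht hst
    obtain ⟨x, -, rfl⟩ := hi hu
    exact ⟨x, cycleMap_coe hs x⟩

theorem linkEDist_cycleMap (x y : AddCircle ((5 : ℕ) * edgeAngle s)) :
    linkEDist K s (cycleMap hs p x) (cycleMap hs p y) = edist x y := by
  refine le_antisymm ?_ ?_
  · obtain ⟨y, rfl⟩ := QuotientAddGroup.mk_surjective y
    obtain ⟨c, hc, hc'⟩ := AddCircle.exists_coe_eq_norm _ (x - (y : AddCircle _))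
    have hx : x = ((y + c : ℝ) : AddCircle ((5 : ℕ) * edgeAngle s)) := by
      rw [AddCircle.coe_add, hc]; abel
    have e : edist x (y : AddCircle ((5 : ℕ) * edgeAngle s)) = ENNReal.ofReal |c| := by
      rw [hc', ← dist_eq_norm, edist_dist]
    change linkEDist K s _ (cycleMap hs p (y : AddCircle _)) ≤
      edist x (y : AddCircle ((5 : ℕ) * edgeAngle s))
    rw [e, hx, cycleMap_coe, cycleMap_coe]
    rcases le_total 0 c with h | h
    · have := (linkEDist_cyclePath_le hs hp hps hK (x := y) (y := y + c) (by linarith)).2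
      rw [abs_of_nonneg h]
      rwa [add_sub_cancel_left] at this
    · have := (linkEDist_cyclePath_le hs hp hps hK (x := y + c) (y := y) (by linarith)).1
      rw [abs_of_nonpos h]
      rwa [show y - (y + c) = -c by ring] at this
  -- For the lower bound, transport the circle metric to the link by the inverse map. It obeys the
  -- triangle inequality and on each cell is at most the angle, so `le_linkEDist` applies.
  · have hinv := Function.leftInverse_invFun (cycleMap_injective hs hp hps)
    have hmem : ∀ x, cycleMap hs p x ∈ link K s := fun x =>
      range_cycleMap hs hp hps hK ▸ mem_range_self x
    have := le_linkEDist (K := K) (s := s) (u := cycleMap hs p x) (v := cycleMap hs p y)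
      (fun u v => edist (Function.invFun (cycleMap hs p) u) (Function.invFun (cycleMap hs p) v))
      (fun u _ => edist_self _) (fun u v w _ _ _ => edist_triangle _ _ _) ?_ (hmem x)
    · simpa only [hinv x, hinv y] using this
    · intro t ht hst u hu v hv
      obtain ⟨i, hi⟩ := exists_linkCell_subset hs hp hps hK ht hst
      obtain ⟨x, hx, rfl⟩ := hi hu
      obtain ⟨y, hy, rfl⟩ := hi hv
      rw [angle_cyclePath hs hp hps i hx hy, ← cycleMap_coe hs, ← cycleMap_coe hs, hinv, hinv,
        edist_dist, dist_eq_norm, ← AddCircle.coe_sub]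
      exact ENNReal.ofReal_le_ofReal (AddCircle.norm_coe_le_abs _ _)

/-- The link of `s` in the cyclic complex with the five maximal simplices `s ∪ {p i, p (i + 1)}` is
a cycle of five edges. -/
theorem linkIsCycle {t : ZMod 5 → Finset V} (ht : ∀ i, t i = s ∪ {p i, p (i + 1)}) :
    LinkIsCycle K s 5 (edgeAngle s) t := by
  have hmem : ∀ i j, p j ∈ t i ↔ j = i ∨ j = i + 1 := by
    intro i j
    simp [ht, hps, hp.eq_iff]
  have htt : ∀ i, t i ∩ t (i + 1) = s ∪ {p (i + 1)} := by
    intro i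
    ext x
    have h1 : ∀ z : ZMod 5, z ≠ z + 1 ∧ z ≠ z + 1 + 1 := by decide
    simp only [ht, Finset.mem_inter, Finset.mem_union, Finset.mem_insert, Finset.mem_singleton]
    constructor
    · rintro ⟨h | rfl | rfl, h' | h' | h'⟩
      all_goals first
        | exact Or.inl h
        | exact Or.inl h'
        | exact Or.inr rfl
        | exact absurd (hp h') (h1 i).1
        | exact absurd (hp h') (h1 i).2
    · rintro (h | rfl) <;> simp [*]
  refine ⟨edgeAngle_pos hs, ?_, fun i => ?_, ?_, cycleMap hs p, range_cycleMap hs hp hps hK,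
    linkEDist_cycleMap hs hp hps hK, fun i => ?_, fun i => ?_⟩
  · intro i j hij
    have h1 := (hmem j i).1 (hij ▸ (hmem i i).2 (Or.inl rfl))
    have h2 := (hmem j (i + 1)).1 (hij ▸ (hmem i (i + 1)).2 (Or.inr rfl))
    have h : ∀ i j : ZMod 5, i = j ∨ i = j + 1 → i + 1 = j ∨ i + 1 = j + 1 → i = j := by decide
    exact h i j h1 h2
  · rw [ht]
    exact ⟨(hK _ Finset.subset_union_left).2 ⟨i, subset_rfl⟩, Finset.subset_union_left⟩
  · intro r hr hsr
    obtain ⟨i, hi⟩ := (hK r hsr.1).1 hr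
    have hor : ∀ x ∈ r, x ∈ s ∨ x = p i ∨ x = p (i + 1) := fun x hx => by
      simpa only [Finset.mem_union, Finset.mem_insert, Finset.mem_singleton] using hi hx
    by_cases h1 : p i ∈ r
    · by_cases h2 : p (i + 1) ∈ r
      · refine Or.inl ⟨i, hi.antisymm ?_ |>.trans (ht i).symm⟩
        refine Finset.union_subset hsr.1 ?_
        simp [Finset.insert_subset_iff, h1, h2]
      -- The face is `s ∪ {p i}`, shared by the edges `i - 1` and `i`.
      · refine Or.inr ⟨i - 1, ?_⟩
        rw [htt, sub_add_cancel]
        refine Finset.Subset.antisymm (fun x hx => ?_)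
          (Finset.union_subset hsr.1 (by simpa using h1))
        rcases hor x hx with h | rfl | rfl
        · simp [h]
        · simp
        · exact absurd hx h2
    · refine Or.inr ⟨i, ?_⟩
      rw [htt]
      have h2 : p (i + 1) ∈ r := by
        by_contra h2
        refine hsr.2 fun x hx => ?_
        rcases hor x hx with h | rfl | rfl
        · exact h
        · exact absurd hx h1
        · exact absurd hx h2
      refine Finset.Subset.antisymm (fun x hx => ?_)
        (Finset.union_subset hsr.1 (by simpa using h2))
      rcases hor x hx with h | rfl | rfl
      · simp [h]
      · exact absurd hx h1
      · simp
  · rw [image_image, ht]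
    have := cyclePath_image_Icc hs hp hps i
    push_cast at this
    rw [← this]
    exact image_congr fun x _ => cycleMap_coe hs x
  · rw [htt, linkCell_vertex hs (hps _)]
    have h := cyclePath_eq_arc (p := p) hs i (x := (i + 1) * edgeAngle s)
      ⟨by push_cast; nlinarith [edgeAngle_pos hs], by push_cast; exact le_rfl⟩
    rw [cycleMap_coe hs, h]
    push_cast
    rw [show ((i : ℝ) + 1) * edgeAngle s - i * edgeAngle s = edgeAngle s by ring,
      arc_end (sin_edgeAngle_pos hs).ne']

end CyclicLink

/-! ### Locally isometric paths in a circle -/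

section Circles

variable {L : ℝ} {g : ℝ → AddCircle L}

theorem AddCircle.norm_coe_of_abs_le (hL : 0 < L) {c : ℝ} (hc : |c| ≤ L / 2) :
    ‖(c : AddCircle L)‖ = |c| :=
  (AddCircle.norm_coe_eq_abs_iff L hL.ne').2 (by rwa [abs_of_pos hL])

/-- A locally isometric path in a circle runs locally in the positive or in the negative
direction. -/
theorem eventually_eq_or_eventually_eq_of_isometric (hL : 0 < L) {x ε : ℝ} (hε : 0 < ε)
    (h : ∀ y ∈ ball x ε, ∀ z ∈ ball x ε, dist (g y) (g z) = |y - z|) :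
    (∀ᶠ y in nhds x, g y - (y : AddCircle L) = g x - (x : AddCircle L)) ∨
    (∀ᶠ y in nhds x, g y + (y : AddCircle L) = g x + (x : AddCircle L)) := by
  -- Displacements below `L / 4` differ by at most `L / 2`, where the circle distance is the
  -- absolute value.
  obtain ⟨η, hη0, hηε, hηL⟩ : ∃ η : ℝ, 0 < η ∧ η ≤ ε ∧ η ≤ L / 4 :=
    ⟨min ε (L / 4), by positivity, min_le_left _ _, min_le_right _ _⟩
  have hx : x ∈ ball x ε := mem_ball_self hε
  have step : ∀ t, |t| < η → ∃ c : ℝ, g (x + t) = g x + (c : AddCircle L) ∧ (c = t ∨ c = -t) := by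
    intro t ht
    have ht' : x + t ∈ ball x ε := by
      rw [mem_ball, dist_eq_norm]; simpa using ht.trans_le hηε
    obtain ⟨c, hc, hc'⟩ := AddCircle.exists_coe_eq_norm L (g (x + t) - g x)
    refine ⟨c, by rw [hc]; abel, abs_eq_abs.1 ?_⟩
    rw [hc', ← dist_eq_norm, h _ ht' _ hx, add_sub_cancel_left]
  have compare : ∀ t t' c c' : ℝ, |t| < η → |t'| < η → g (x + t) = g x + (c : AddCircle L) →
      g (x + t') = g x + (c' : AddCircle L) → (c = t ∨ c = -t) → (c' = t' ∨ c' = -t') →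
      |c - c'| = |t - t'| := by
    intro t t' c c' ht ht' hc hc' hct hct'
    have e := h (x + t) (by rw [mem_ball, dist_eq_norm]; simpa using ht.trans_le hηε)
      (x + t') (by rw [mem_ball, dist_eq_norm]; simpa using ht'.trans_le hηε)
    rw [hc, hc', dist_add_left, dist_eq_norm, ← AddCircle.coe_sub,
      AddCircle.norm_coe_of_abs_le hL, add_sub_add_left_eq_sub] at e
    · exact e
    · rw [abs_lt] at ht ht'
      rw [abs_le]
      rcases hct with rfl | rfl <;> rcases hct' with rfl | rfl <;> constructor <;> linarith
  have hη2 : |η / 2| < η := by rw [abs_of_pos (by linarith)]; linarith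
  -- The sign of one reference displacement fixes the orientation: comparison with `c₀` forces the
  -- same sign on all the others.
  obtain ⟨c₀, hc₀, hcc₀⟩ := step (η / 2) hη2
  have hev : ∀ᶠ y in nhds x, |y - x| < η := by
    filter_upwards [ball_mem_nhds x hη0] with y hy
    rwa [mem_ball, dist_eq_norm] at hy
  have key : ∀ y, |y - x| < η → ∃ c : ℝ, g y = g x + (c : AddCircle L) ∧
      (c = y - x ∨ c = -(y - x)) ∧ |c - c₀| = |(y - x) - η / 2| := by
    intro y hy
    obtain ⟨c, hc, hct⟩ := step (y - x) hy
    refine ⟨c, by rw [← hc]; congr 1; ring, hct, compare _ _ _ _ hy hη2 hc hc₀ hct hcc₀⟩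
  rcases hcc₀ with rfl | rfl
  · left
    filter_upwards [hev] with y hy
    obtain ⟨c, hc, hct, e⟩ := key y hy
    have : c = y - x := by
      rcases hct with h | h
      · exact h
      · rw [h, abs_eq_abs] at e
        rcases e with e | e <;> linarith
    rw [hc, this, AddCircle.coe_sub]
    abel
  · right
    filter_upwards [hev] with y hy
    obtain ⟨c, hc, hct, e⟩ := key y hy
    have : c = -(y - x) := by
      rcases hct with h | h
      · rw [h, abs_eq_abs] at e
        rcases e with e | e <;> linarith
      · exact h
    rw [hc, this, AddCircle.coe_neg, AddCircle.coe_sub]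
    abel

/-- The sets where the path runs forwards and backwards are open and cover the line. A common point
would give `2 * (y - x) = 0` in the circle for all nearby `y`, so they are disjoint, and
connectedness leaves one of them. -/
theorem isLocallyConstant_or_of_isometric (hL : 0 < L)
    (h : ∀ x, ∃ ε > 0, ∀ y ∈ ball x ε, ∀ z ∈ ball x ε, dist (g y) (g z) = |y - z|) :
    (∀ x y, g x - (x : AddCircle L) = g y - (y : AddCircle L)) ∨
    (∀ x y, g x + (x : AddCircle L) = g y + (y : AddCircle L)) := by
  have open_of : ∀ f : ℝ → AddCircle L, IsOpen {x | ∀ᶠ y in nhds x, f y = f x} := by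
    intro f
    refine isOpen_iff_mem_nhds.2 fun x (hx : ∀ᶠ y in nhds x, f y = f x) => ?_
    filter_upwards [hx, eventually_eventually_nhds.2 hx] with y hy hy'
    filter_upwards [hy'] with z hz
    rw [hz, hy]
  set A : Set ℝ := {x | ∀ᶠ y in nhds x, g y - (y : AddCircle L) = g x - (x : AddCircle L)} with hA
  set B : Set ℝ := {x | ∀ᶠ y in nhds x, g y + (y : AddCircle L) = g x + (x : AddCircle L)} with hB
  have hAB : univ ⊆ A ∪ B := fun x _ => by
    obtain ⟨ε, hε, hx⟩ := h x
    exact eventually_eq_or_eventually_eq_of_isometric hL hε hx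
  have hdisj : ¬ (univ ∩ (A ∩ B)).Nonempty := by
    rintro ⟨x, -, ha, hb⟩
    have hev : ∀ᶠ y in nhds x, |y - x| < L / 4 := by
      filter_upwards [ball_mem_nhds x (show 0 < L / 4 by linarith)] with y hy
      rwa [mem_ball, dist_eq_norm] at hy
    have : ∀ᶠ y in nhds x, y = x := by
      filter_upwards [ha, hb, hev] with y ha hb hy
      have e : ((2 * (y - x) : ℝ) : AddCircle L) = 0 := by
        rw [two_mul, AddCircle.coe_add, AddCircle.coe_sub]
        have h1 : g y + (y : AddCircle L) - (g y - (y : AddCircle L)) =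
          g x + (x : AddCircle L) - (g x - (x : AddCircle L)) := by rw [ha, hb]
        have h2 : (y : AddCircle L) + y = x + x := by
          calc (y : AddCircle L) + y = g y + (y : AddCircle L) - (g y - (y : AddCircle L)) := by
                abel
            _ = x + x := by rw [h1]; abel
        calc (y : AddCircle L) - x + (y - x) = (y + y) - (x + x) := by abel
          _ = 0 := by rw [h2, sub_self]
      have h3 := AddCircle.norm_coe_of_abs_le hL (c := 2 * (y - x))
        (by rw [abs_mul, abs_of_pos (two_pos : (0 : ℝ) < 2)]; linarith)
      rw [e, norm_zero, eq_comm, abs_eq_zero] at h3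
      linarith
    obtain ⟨ε, hε, hball⟩ := Metric.eventually_nhds_iff.1 this
    have := hball (y := x + ε / 2) (by rw [dist_eq_norm]; simp [abs_of_pos hε, hε])
    linarith
  have hcases : A = univ ∨ B = univ := by
    by_contra! hne
    obtain ⟨⟨a, ha⟩, b, hb⟩ := And.imp (ne_univ_iff_exists_notMem _).1
      (ne_univ_iff_exists_notMem _).1 hne
    exact hdisj (isPreconnected_univ A B (open_of _) (open_of _) hAB
      ⟨b, mem_univ _, (hAB (mem_univ b)).resolve_right hb⟩
      ⟨a, mem_univ _, (hAB (mem_univ a)).resolve_left ha⟩)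
  refine hcases.imp (fun hA' => ?_) (fun hB' => ?_)
  · have hlc : IsLocallyConstant fun x : ℝ => g x - (x : AddCircle L) :=
      (IsLocallyConstant.iff_eventually_eq _).2 fun x => (hA' ▸ mem_univ x : x ∈ A)
    exact fun x y => hlc.apply_eq_of_preconnectedSpace x y
  · have hlc : IsLocallyConstant fun x : ℝ => g x + (x : AddCircle L) :=
      (IsLocallyConstant.iff_eventually_eq _).2 fun x => (hB' ▸ mem_univ x : x ∈ B)
    exact fun x y => hlc.apply_eq_of_preconnectedSpace x y

/-- A closed locally isometric path in a circle is at least as long as the circle. -/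
theorem le_of_isometric_of_eq (hL : 0 < L)
    (h : ∀ x, ∃ ε > 0, ∀ y ∈ ball x ε, ∀ z ∈ ball x ε, dist (g y) (g z) = |y - z|) {ℓ : ℝ}
    (hℓ : 0 < ℓ) (hg : g ℓ = g 0) : L ≤ ℓ := by
  -- The path is a translation or a reflection of the covering map, so it closes up only after a
  -- multiple of `L`.
  have h0 : (ℓ : AddCircle L) = 0 := by
    rcases isLocallyConstant_or_of_isometric hL h with h | h
    · have := h ℓ 0
      rwa [hg, AddCircle.coe_zero, sub_zero, sub_eq_self] at this
    · have := h ℓ 0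
      rwa [hg, AddCircle.coe_zero, add_zero, add_eq_left] at this
  obtain ⟨n, hn⟩ := (AddCircle.coe_eq_zero_iff L).1 h0
  rw [zsmul_eq_mul] at hn
  have hn1 : 1 ≤ n := by
    by_contra! hlt
    have : (n : ℝ) ≤ 0 := by exact_mod_cast Int.lt_add_one_iff.1 hlt
    nlinarith
  have : (1 : ℝ) ≤ n := by exact_mod_cast hn1
  nlinarith

end Circles

/-! ### Loops in links that are cycles -/

section CycleLinks

variable {V : Type*} [Fintype V] [DecidableEq V] {K : PreAbstractSimplicialComplex V}
  {s : Finset V} {k : ℕ} {a : ℝ} {t : ZMod k → Finset V}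

theorem linkEDist_self (K : PreAbstractSimplicialComplex V) (s : Finset V)
    (u : EuclideanSpace ℝ V) : linkEDist K s u u = 0 :=
  le_antisymm (iInf_le_of_le 0 (iInf_le_of_le (fun _ => u)
    (iInf_le_of_le ⟨rfl, rfl, fun i hi => absurd hi (by omega)⟩ (by simp)))) bot_le

theorem injective_of_linkEDist_eq {X : Type*} [MetricSpace X] {ρ : X → EuclideanSpace ℝ V}
    (h : ∀ x y, linkEDist K s (ρ x) (ρ y) = edist x y) : Function.Injective ρ := by
  intro x y hxy
  rw [← edist_eq_zero, ← h, hxy, linkEDist_self]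

theorem continuous_of_linkEDist_eq {X : Type*} [MetricSpace X] {ρ : X → EuclideanSpace ℝ V}
    (hmem : ∀ x, ρ x ∈ link K s)
    (h : ∀ x y, linkEDist K s (ρ x) (ρ y) = edist x y) : Continuous ρ := by
  refine (LipschitzWith.of_dist_le_mul (K := 1) fun x y => ?_).continuous
  have h1 := angle_le_linkEDist (v := ρ y) (hmem x)
  rw [h, edist_dist, ENNReal.ofReal_le_ofReal_iff dist_nonneg] at h1
  simpa using (dist_le_angle (norm_eq_one_of_mem_link (hmem x))
    (norm_eq_one_of_mem_link (hmem y))).trans h1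

theorem LinkIsCycle.exists_isLocallyGeodesicLoop (h : LinkIsCycle K s k a t) (hk : 0 < k) :
    ∃ ρ, IsLocallyGeodesicLoop K s (k * a) ρ := by
  obtain ⟨ha, -, -, -, ρ, hr, hd, -, -⟩ := h
  have hk' : (0 : ℝ) < k := by exact_mod_cast hk
  exact ⟨ρ, by positivity, fun x => hr ▸ mem_range_self x, injective_of_linkEDist_eq hd,
    fun x => ⟨1, one_pos, fun y _ z _ => hd y z⟩⟩

/-- Read the loop in the circle that parametrizes the link and unroll its domain to `ℝ`; this
reduces to `le_of_isometric_of_eq`. -/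
theorem LinkIsCycle.le_of_isLocallyGeodesicLoop (h : LinkIsCycle K s k a t) (hk : 0 < k) {ℓ : ℝ}
    {ρ : AddCircle ℓ → EuclideanSpace ℝ V} (hρ : IsLocallyGeodesicLoop K s ℓ ρ) : k * a ≤ ℓ := by
  obtain ⟨ha, -, -, -, τ, hr, hd, -, -⟩ := h
  have hk' : (0 : ℝ) < k := by exact_mod_cast hk
  have hmem : ∀ x, ∃ y, τ y = ρ x := fun x => by
    have := hρ.mem x
    rwa [← hr] at this
  choose σ hσ using hmem
  refine le_of_isometric_of_eq (g := fun x : ℝ => σ (x : AddCircle ℓ)) (by positivity)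
    (fun x => ?_) hρ.pos (by simp [AddCircle.coe_period])
  obtain ⟨ε, hε, hiso⟩ := hρ.isometric x
  -- Points within `ℓ / 4` of `x` are at most `ℓ / 2` apart, so their distance survives in the
  -- quotient circle.
  refine ⟨min ε (ℓ / 4), lt_min hε (by linarith [hρ.pos]), fun y hy z hz => ?_⟩
  have hball : ∀ w ∈ ball x (min ε (ℓ / 4)), (w : AddCircle ℓ) ∈ ball (x : AddCircle ℓ) ε := by
    intro w hw
    rw [mem_ball, dist_eq_norm] at hw ⊢
    rw [← AddCircle.coe_sub]
    exact (AddCircle.norm_coe_le_abs ℓ _).trans_lt (hw.trans_le (min_le_left _ _))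
  have e := hiso y (hball y hy) z (hball z hz)
  rw [← hσ, ← hσ, hd, edist_dist, edist_dist, ENNReal.ofReal_eq_ofReal_iff dist_nonneg
    dist_nonneg] at e
  rw [e, dist_eq_norm, ← AddCircle.coe_sub, AddCircle.norm_coe_of_abs_le hρ.pos]
  have hy' := (mem_ball.1 hy).trans_le (min_le_right _ _)
  have hz' := (mem_ball.1 hz).trans_le (min_le_right _ _)
  rw [Real.dist_eq, abs_lt] at hy' hz'
  rw [abs_le]
  constructor <;> linarith

end CycleLinks

/-! ### Elementary plane topology -/

section PlaneTopology

/-- There is no continuous injection of an open subset of the plane into the line. -/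
theorem not_injOn_real_of_isOpen {O : Set ℂ} (hO : IsOpen O) (hne : O.Nonempty) {f : ℂ → ℝ}
    (hf : ContinuousOn f O) : ¬ InjOn f O := by
  intro hinj
  obtain ⟨c, hc⟩ := hne
  obtain ⟨r, hr, hball⟩ := Metric.isOpen_iff.1 hO c hc
  have hmem : ∀ θ : ℝ, c + (r / 2 : ℝ) * Complex.exp (θ * Complex.I) ∈ O ∧
      c - (r / 2 : ℝ) * Complex.exp (θ * Complex.I) ∈ O := by
    intro θ
    constructor <;> refine hball ?_ <;> rw [mem_ball, dist_eq_norm] <;>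
    · simp only [add_sub_cancel_left, sub_sub_cancel_left, norm_neg, norm_mul,
        Complex.norm_exp_ofReal_mul_I, Complex.norm_real, Real.norm_eq_abs]
      rw [abs_of_pos (by linarith)]
      linarith
  -- The difference of antipodal values on a small circle changes sign over a half turn, so it
  -- vanishes somewhere.
  set d : ℝ → ℝ := fun θ => f (c + (r / 2 : ℝ) * Complex.exp (θ * Complex.I)) -
    f (c - (r / 2 : ℝ) * Complex.exp (θ * Complex.I)) with hd
  have hdc : Continuous d :=
    (hf.comp_continuous (by fun_prop) fun θ => (hmem θ).1).sub
      (hf.comp_continuous (by fun_prop) fun θ => (hmem θ).2)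
  have hπ : d π = -d 0 := by
    simp [hd, Complex.exp_pi_mul_I, sub_eq_add_neg]
  obtain ⟨θ, hθ⟩ : ∃ θ, d θ = 0 := by
    rcases le_total (d 0) 0 with h | h
    · exact mem_range_of_exists_le_of_exists_ge hdc ⟨0, h⟩ ⟨π, by rw [hπ]; linarith⟩
    · exact mem_range_of_exists_le_of_exists_ge hdc ⟨π, by rw [hπ]; linarith⟩ ⟨0, h⟩
  have e := hinj (hmem θ).1 (hmem θ).2 (sub_eq_zero.1 hθ)
  have : (2 : ℂ) * ((r / 2 : ℝ) * Complex.exp (θ * Complex.I)) = 0 := by linear_combination e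
  simp [hr.ne', Complex.exp_ne_zero] at this

/-- Divided by `2πi`, such a function is continuous with integer values. -/
theorem eq_of_exp_eq_one {f : ℝ → ℂ} (hf : Continuous f) (h : ∀ x, Complex.exp (f x) = 1)
    (x y : ℝ) : f x = f y := by
  choose n hn using fun x => Complex.exp_eq_one_iff.1 (h x)
  have hn' : ∀ x, ((n x : ℤ) : ℝ) = (f x).im / (2 * π) := by
    intro x
    rw [hn x]
    simp [pi_ne_zero]
  have hc : Continuous n := by
    refine Int.isClosedEmbedding_coe_real.isEmbedding.continuous_iff.2 ?_
    rw [show ((fun m : ℤ => (m : ℝ)) ∘ n) = fun x => (f x).im / (2 * π) from funext hn']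
    exact (Complex.continuous_im.comp hf).div_const _
  rw [hn x, hn y, PreconnectedSpace.constant inferInstance hc (x := x) (y := y)]

/-- A circle around the origin cannot be contracted in the punctured plane. -/
theorem not_contractible_circle {F : ℝ × ℝ → ℂ} (hF : Continuous F) (h0 : ∀ x, F x ≠ 0) {r : ℝ}
    (hr : 0 < r) (hF0 : ∀ θ : ℝ, F (0, θ) = r * Complex.exp (θ * Complex.I))
    (hF1 : ∀ θ, F (1, θ) = F (1, 0)) (hper : ∀ t, F (t, 2 * π) = F (t, 0)) : False := by
  have hsc : IsSimplyConnected (univ : Set (ℝ × ℝ)) := by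
    have := (convex_univ (𝕜 := ℝ) (E := ℝ × ℝ)).contractibleSpace univ_nonempty
    exact SimplyConnectedSpace.ofContractible _
  -- A continuous logarithm over the whole plane. Its increment over a full turn is `2πi` at time
  -- `0`, zero at time `1`, and independent of time: `e0`, `e1`, `e2` are incompatible.
  obtain ⟨G, hG, hGF⟩ := Complex.exists_continuousOn_eqOn_exp_comp hsc isOpen_univ
    hF.continuousOn (by simpa using h0)
  rw [continuousOn_univ] at hG
  have hGF' : ∀ x, Complex.exp (G x) = F x := fun x => hGF (mem_univ x)
  have e0 := eq_of_exp_eq_one (f := fun θ : ℝ => G (0, θ) - (Real.log r + θ * Complex.I))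
    (by fun_prop) (fun θ => by
      rw [Complex.exp_sub, hGF', hF0, Complex.exp_add, ← Complex.ofReal_exp, Real.exp_log hr,
        div_self]
      simp [hr.ne', Complex.exp_ne_zero]) (2 * π) 0
  have e1 := eq_of_exp_eq_one (f := fun θ : ℝ => G (1, θ) - G (1, 0))
    (by fun_prop) (fun θ => by
      rw [Complex.exp_sub, hGF', hGF', hF1, div_self (h0 _)]) (2 * π) 0
  have e2 := eq_of_exp_eq_one (f := fun t : ℝ => G (t, 2 * π) - G (t, 0))
    (by fun_prop) (fun t => by
      rw [Complex.exp_sub, hGF', hGF', hper, div_self (h0 _)]) 0 1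
  simp only [Complex.ofReal_mul, Complex.ofReal_ofNat, Complex.ofReal_zero, sub_self] at e0 e1 e2
  have : (2 * π * Complex.I : ℂ) = 0 := by linear_combination e1 - e0 + e2
  simp [pi_ne_zero] at this

end PlaneTopology

/-! ### Local structure of triangulated disks -/

section DiskTopology

variable {V : Type*} [Fintype V] [DecidableEq V] {D : PreAbstractSimplicialComplex V}

theorem subset_of_mem_cell {s r : Finset V} {x : EuclideanSpace ℝ V} (hx : x ∈ cell r)
    (h : ∀ v ∈ s, 0 < x v) : s ⊆ r := by
  intro v hv
  by_contra hvr
  exact (h v hv).ne' ((mem_cell_iff.1 hx).2.1 v hvr)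

theorem exists_mem_cell_pos {s : Finset V} (hs : s.Nonempty) :
    ∃ x ∈ cell s, ∀ v ∈ s, 0 < x v := by
  have hcard : (0 : ℝ) < s.card := by exact_mod_cast hs.card_pos
  have hpos : 0 < (s.card : ℝ)⁻¹ * (√2)⁻¹ := by positivity
  refine ⟨barycenter s, mem_cell_iff.2 ⟨fun v => ?_, fun v hv => ?_, ?_⟩, fun v hv => ?_⟩
  · rw [barycenter_apply]; split_ifs <;> positivity
  · rw [barycenter_apply, if_neg hv]
  · simp only [barycenter_apply, Finset.sum_ite_mem, Finset.univ_inter, Finset.sum_const,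
      nsmul_eq_mul]
    field_simp
  · rw [barycenter_apply, if_pos hv]; exact hpos

theorem isOpen_openStar (D : PreAbstractSimplicialComplex V) (s : Finset V) :
    IsOpen {x : realization D | ∀ v ∈ s, 0 < (x : EuclideanSpace ℝ V) v} := by
  rw [show {x : realization D | ∀ v ∈ s, 0 < (x : EuclideanSpace ℝ V) v} =
    ⋂ v ∈ s, {x : realization D | 0 < (x : EuclideanSpace ℝ V) v} by ext; simp]
  exact isOpen_biInter_finset fun v _ => isOpen_lt continuous_const (by fun_prop)

/-- In a triangulated disk every simplex lies in a triangle. -/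
theorem exists_triangle (hD : ∀ s ∈ D, s.card ≤ 3)
    (h : realization D ≃ₜ closedBall (0 : ℂ) 1) {s : Finset V} (hs : s ∈ D) :
    ∃ t ∈ D, s ⊆ t ∧ t.card = 3 := by
  obtain ⟨t, ⟨ht, hst⟩, hmax⟩ := (Set.toFinite {t | t ∈ D ∧ s ⊆ t}).exists_maximalFor
    (fun t => t.card) _ ⟨s, hs, subset_rfl⟩
  refine ⟨t, ht, hst, le_antisymm (hD t ht) ?_⟩
  by_contra! hlt
  have hne : t.Nonempty := (D.isRelLowerSet_faces ht).1
  have hmax' : ∀ r ∈ D, t ⊆ r → r = t := fun r hr htr =>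
    (Finset.eq_of_subset_of_card_le htr
      (hmax ⟨hr, hst.trans htr⟩ (Finset.card_le_card htr))).symm
  set U : Set (realization D) := {x | ∀ v ∈ t, 0 < (x : EuclideanSpace ℝ V) v} with hU
  have hUo : IsOpen U := isOpen_openStar D t
  -- The open star of the maximal simplex `t` lies in its own cell.
  have hUcell : ∀ x ∈ U, (x : EuclideanSpace ℝ V) ∈ cell t := by
    intro x hx
    obtain ⟨r, hr, hxr⟩ := mem_realization.1 x.2
    rwa [hmax' r hr (subset_of_mem_cell hxr hx)] at hxr
  obtain ⟨w, hw⟩ := hne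
  -- `t` has at most two vertices and the coordinates have a fixed sum, so one coordinate determines
  -- the point.
  have hinj : InjOn (fun x : realization D => (x : EuclideanSpace ℝ V) w) U := by
    intro x hx y hy hxy
    change (x : EuclideanSpace ℝ V) w = (y : EuclideanSpace ℝ V) w at hxy
    obtain ⟨-, x2, x3⟩ := mem_cell_iff.1 (hUcell x hx)
    obtain ⟨-, y2, y3⟩ := mem_cell_iff.1 (hUcell y hy)
    have hsub : (t.erase w).card ≤ 1 := by rw [Finset.card_erase_of_mem hw]; omega
    have hsum : ∀ z : EuclideanSpace ℝ V, (∀ v ∉ t, z v = 0) → ∑ v, z v = (√2)⁻¹ →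
        z w + ∑ v ∈ t.erase w, z v = (√2)⁻¹ := by
      intro z hz hz'
      rw [Finset.add_sum_erase t z hw, Finset.sum_subset (Finset.subset_univ t) fun v _ hv => hz v hv,
        hz']
    have ex := hsum x x2 x3
    have ey := hsum y y2 y3
    refine Subtype.ext ?_
    ext v
    by_cases hv : v ∈ t
    · by_cases hvw : v = w
      · rw [hvw, hxy]
      · have hvt : v ∈ t.erase w := Finset.mem_erase.2 ⟨hvw, hv⟩
        have he : t.erase w = {v} :=
          Finset.eq_singleton_iff_unique_mem.2
            ⟨hvt, fun z hz => Finset.card_le_one.1 hsub z hz v hvt⟩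
        rw [he, Finset.sum_singleton] at ex ey
        linarith
    · rw [x2 v hv, y2 v hv]
  obtain ⟨O, hO, hOU⟩ := isOpen_induced_iff.1 (h.symm.isOpen_preimage.2 hUo)
  obtain ⟨x, hx, hxpos⟩ := exists_mem_cell_pos ⟨w, hw⟩
  have hxU : (⟨x, mem_realization.2 ⟨t, ht, hx⟩⟩ : realization D) ∈ U := hxpos
  -- The image of the open star may touch the unit circle; it meets the open disk because that is
  -- dense in the closed one.
  have hOne : (O ∩ ball 0 1).Nonempty := by
    set z := h ⟨x, mem_realization.2 ⟨t, ht, hx⟩⟩ with hz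
    have hzO : z ∈ Subtype.val ⁻¹' O := by
      rw [hOU, mem_preimage, hz, h.symm_apply_apply]; exact hxU
    have hzc : (z : ℂ) ∈ closure (ball (0 : ℂ) 1) := by
      rw [closure_ball _ one_ne_zero]; exact z.2
    exact mem_closure_iff.1 hzc O hO hzO
  have hmemU : ∀ z (hz : z ∈ O ∩ ball (0 : ℂ) 1),
      h.symm ⟨z, ball_subset_closedBall hz.2⟩ ∈ U := by
    intro z hz
    have : (⟨z, ball_subset_closedBall hz.2⟩ : closedBall (0 : ℂ) 1) ∈ Subtype.val ⁻¹' O := hz.1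
    rwa [hOU] at this
  have hne01 : (0 : ℂ) ∈ closedBall (0 : ℂ) 1 := mem_closedBall_self zero_le_one
  classical
  set f : ℂ → ℝ := fun z => if hz : z ∈ closedBall (0 : ℂ) 1 then
    (h.symm ⟨z, hz⟩ : EuclideanSpace ℝ V) w else 0 with hf
  have hfz : ∀ z (hz : z ∈ O ∩ ball (0 : ℂ) 1),
      f z = (h.symm ⟨z, ball_subset_closedBall hz.2⟩ : EuclideanSpace ℝ V) w := fun z hz => by
    rw [hf]; exact dif_pos (ball_subset_closedBall hz.2)
  refine not_injOn_real_of_isOpen (hO.inter isOpen_ball) hOne (f := f) ?_ ?_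
  · rw [continuousOn_iff_continuous_domRestrict]
    have : (O ∩ ball (0 : ℂ) 1).domRestrict f = fun z : ↥(O ∩ ball (0 : ℂ) 1) =>
        (h.symm ⟨z, ball_subset_closedBall z.2.2⟩ : EuclideanSpace ℝ V) w :=
      funext fun z => hfz z z.2
    rw [this]
    have hc : Continuous fun z : ↥(O ∩ ball (0 : ℂ) 1) =>
      h.symm ⟨z, ball_subset_closedBall z.2.2⟩ := h.symm.continuous.comp (by fun_prop)
    fun_prop
  · intro z hz z' hz' e
    rw [hfz z hz, hfz z' hz'] at e
    have := h.symm.injective (hinj (hmemU z hz) (hmemU z' hz') e)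
    exact congrArg Subtype.val this

/-- In a triangulated disk an edge that lies in only one triangle lies in the boundary circle. -/
theorem norm_eq_one_of_unique_triangle (h : realization D ≃ₜ closedBall (0 : ℂ) 1) {e t : Finset V}
    (ht : t ∈ D) {w : V} (hwt : w ∈ t) (hwe : w ∉ e)
    (hunique : ∀ r ∈ D, e ⊆ r → r ⊆ t) (p : realization D)
    (hp : (p : EuclideanSpace ℝ V) ∈ cell e) (hpos : ∀ v ∈ e, 0 < (p : EuclideanSpace ℝ V) v) :
    ‖(h p : ℂ)‖ = 1 := by
  by_contra hne
  have hlt : ‖(h p : ℂ)‖ < 1 := lt_of_le_of_ne (mem_closedBall_zero_iff.1 (h p).2) hne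
  set U : Set (realization D) := {x | ∀ v ∈ e, 0 < (x : EuclideanSpace ℝ V) v} with hU
  have hUo : IsOpen U := isOpen_openStar D e
  have hUcell : ∀ x ∈ U, (x : EuclideanSpace ℝ V) ∈ cell t := by
    intro x hx
    obtain ⟨r, hr, hxr⟩ := mem_realization.1 x.2
    exact cell_mono (hunique r hr (subset_of_mem_cell hxr hx)) hxr
  obtain ⟨q, hqt, hqpos⟩ := exists_mem_cell_pos ⟨w, hwt⟩
  have het : e ⊆ t := subset_of_mem_cell (hUcell p hpos) hpos
  have hpw : (p : EuclideanSpace ℝ V) w = 0 := (mem_cell_iff.1 hp).2.1 w hwe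
  obtain ⟨O, hO, hOU⟩ := isOpen_induced_iff.1 (h.symm.isOpen_preimage.2 hUo)
  have hpO : (h p : ℂ) ∈ O ∩ ball 0 1 := by
    have : h p ∈ Subtype.val ⁻¹' O := by rw [hOU, mem_preimage, h.symm_apply_apply]; exact hpos
    exact ⟨this, by simpa using hlt⟩
  obtain ⟨ε, hε, hball⟩ := Metric.isOpen_iff.1 (hO.inter isOpen_ball) _ hpO
  have hγ : ∀ θ : ℝ, (h p : ℂ) + (ε / 2 : ℝ) * Complex.exp (θ * Complex.I) ∈ O ∩ ball 0 1 := by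
    intro θ
    refine hball ?_
    rw [mem_ball, dist_eq_norm, add_sub_cancel_left, norm_mul, Complex.norm_exp_ofReal_mul_I,
      Complex.norm_real, Real.norm_eq_abs, abs_of_pos (by linarith)]
    linarith
  set Y : ℝ → realization D := fun θ => h.symm ⟨_, ball_subset_closedBall (hγ θ).2⟩ with hY
  have hYc : Continuous Y := h.symm.continuous.comp (by fun_prop)
  have hYU : ∀ θ, Y θ ∈ U := by
    intro θ
    have : (⟨_, ball_subset_closedBall (hγ θ).2⟩ : closedBall (0 : ℂ) 1) ∈ Subtype.val ⁻¹' O :=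
      (hγ θ).1
    rwa [hOU] at this
  have hYp : ∀ θ, Y θ ≠ p := by
    intro θ hθ
    have := congrArg (fun x => (h x : ℂ)) hθ
    simp [hY, hε.ne', Complex.exp_ne_zero] at this
  -- Clamping the time extends the homotopy to all of `ℝ × ℝ`, as `not_contractible_circle` demands.
  set c : ℝ → ℝ := fun t => max 0 (min t 1) with hc
  have hc0 : ∀ t, 0 ≤ c t := fun t => le_max_left _ _
  have hc1 : ∀ t, c t ≤ 1 := fun t => max_le zero_le_one (min_le_right _ _)
  -- The pulled-back small circle `Y` around `p` lies in the single cell of `t`, which is convex, so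
  -- it contracts there to the point `q`.
  have hmem : ∀ x : ℝ × ℝ, (1 - c x.1) • (Y x.2 : EuclideanSpace ℝ V) + c x.1 • q ∈
      realization D := fun x => mem_realization.2 ⟨t, ht, (convex_convexHull ℝ _)
        (hUcell _ (hYU x.2)) hqt (by linarith [hc1 x.1]) (hc0 _) (by ring)⟩
  have hYper : Y (2 * π) = Y 0 := by
    simp only [hY]
    congr 3
    simp [Complex.exp_two_pi_mul_I]
  have hcc : Continuous c := by fun_prop
  refine not_contractible_circle (F := fun x => (h ⟨_, hmem x⟩ : ℂ) - h p) (r := ε / 2) ?_ ?_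
    (by linarith) ?_ ?_ ?_
  · have : Continuous fun x : ℝ × ℝ => (⟨_, hmem x⟩ : realization D) := by fun_prop
    fun_prop
  -- The contraction misses `p`: the coordinate at `w` vanishes at `p` and is positive at `q`, so a
  -- hit occurs only at time `0`, where `Y` avoids `p`.
  · intro x hx
    have e1 := h.injective (Subtype.ext (sub_eq_zero.1 hx))
    have e2 : (1 - c x.1) • (Y x.2 : EuclideanSpace ℝ V) + c x.1 • q = p :=
      congrArg Subtype.val e1
    have e3 := congrArg (fun z : EuclideanSpace ℝ V => z w) e2
    simp only [PiLp.add_apply, PiLp.smul_apply, smul_eq_mul, hpw] at e3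
    have n1 := mul_nonneg (sub_nonneg.2 (hc1 x.1))
      ((mem_cell_iff.1 (hUcell _ (hYU x.2))).1 w)
    have n2 := mul_nonneg (hc0 x.1) (hqpos w hwt).le
    have n3 : c x.1 = 0 := by
      have : c x.1 * q w = 0 := by linarith
      exact (mul_eq_zero.1 this).resolve_right (hqpos w hwt).ne'
    rw [n3] at e2
    exact hYp x.2 (Subtype.ext (by simpa using e2))
  · intro θ
    have : (⟨_, hmem (0, θ)⟩ : realization D) = Y θ := Subtype.ext (by simp [hc])
    change (h ⟨_, hmem (0, θ)⟩ : ℂ) - h p = _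
    rw [this, hY, h.apply_symm_apply]
    simp
  · intro θ
    have : (⟨_, hmem (1, θ)⟩ : realization D) = ⟨_, hmem (1, 0)⟩ := Subtype.ext (by simp [hc])
    change (h ⟨_, hmem (1, θ)⟩ : ℂ) - h p = h ⟨_, hmem (1, 0)⟩ - h p
    rw [this]
  · intro t
    have : (⟨_, hmem (t, 2 * π)⟩ : realization D) = ⟨_, hmem (t, 0)⟩ :=
      Subtype.ext (by simp only [hYper])
    change (h ⟨_, hmem (t, 2 * π)⟩ : ℂ) - h p = h ⟨_, hmem (t, 0)⟩ - h p
    rw [this]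

end DiskTopology

/-! ### Polar coordinates with values in a circle of given length -/

section PolarCoordinates

/-- The angular coordinate on the plane, with values in the circle of length `L`. -/
noncomputable def circleArg (L : ℝ) (hL : L ≠ 0) (z : ℂ) : AddCircle L :=
  AddCircle.homeomorphAddCircle (2 * π) L two_pi_pos.ne' hL (z.arg : Real.Angle)

theorem continuousAt_circleArg {L : ℝ} (hL : L ≠ 0) {z : ℂ} (hz : z ≠ 0) :
    ContinuousAt (circleArg L hL) z :=
  (Homeomorph.continuous _).continuousAt.comp (Complex.continuousAt_arg_coe_angle hz)

theorem eq_of_norm_eq_of_circleArg_eq {L : ℝ} (hL : L ≠ 0) {z w : ℂ} (h : ‖z‖ = ‖w‖)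
    (h' : circleArg L hL z = circleArg L hL w) : z = w := by
  have e : (z.arg : Real.Angle) = w.arg := (Homeomorph.injective _) h'
  exact Complex.ext_norm_arg h (Complex.arg_coe_angle_eq_iff.1 e)

theorem exists_norm_circleArg {L : ℝ} (hL : L ≠ 0) {r : ℝ} (hr : 0 < r) (x : AddCircle L) :
    ∃ z : ℂ, ‖z‖ = r ∧ circleArg L hL z = x := by
  obtain ⟨φ, rfl⟩ := (AddCircle.homeomorphAddCircle (2 * π) L two_pi_pos.ne' hL).surjective x
  refine ⟨r * (Complex.cos (Real.Angle.toReal φ) + Complex.sin (Real.Angle.toReal φ) * Complex.I),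
    ?_, ?_⟩
  · rw [← Complex.exp_mul_I, norm_mul, Complex.norm_exp_ofReal_mul_I, Complex.norm_real,
      Real.norm_of_nonneg hr.le, mul_one]
  · rw [circleArg, Complex.arg_mul_cos_add_sin_mul_I hr (Real.Angle.toReal_mem_Ioc φ)]
    congr 1
    exact Real.Angle.coe_toReal φ

end PolarCoordinates

/-! ### The cone over a 5-cycle is a disk -/

section ConeDisk

variable {V : Type*} [Fintype V] [DecidableEq V] {L : PreAbstractSimplicialComplex V}

theorem apply_neg_of_mem_linkCell {v : V} {t : Finset V} (hvt : v ∈ t) {u : EuclideanSpace ℝ V}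
    (hu : u ∈ linkCell {v} t) : u v < 0 := by
  obtain ⟨h1, -, h3, -, h5⟩ :=
    (mem_linkCell_iff (Finset.singleton_nonempty v) (by simpa using hvt)).1 hu
  by_contra! hlt
  have h0 : ∀ w, 0 ≤ u w := fun w => by
    by_cases h : w = v
    · rw [h]; exact hlt
    · exact h3 w (by simpa using h)
  have hz := (Finset.sum_eq_zero_iff_of_nonneg fun w _ => h0 w).1 h5
  have : u = 0 := by ext w; exact hz w (Finset.mem_univ w)
  simp [this] at h1

/-- The point of the cone with apex `v` at height `r` in the direction `u`. -/
noncomputable def conePoint (v : V) (r : ℝ) (u : EuclideanSpace ℝ V) : EuclideanSpace ℝ V :=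
  pt v + r • ((√2 * -u v)⁻¹ • u)

/-- The scaling in `conePoint` makes the coordinate at the apex depend on `r` alone. It vanishes
exactly at `r = 1`, so the unit circle goes to the base of the cone. -/
theorem conePoint_apply_self {v : V} {u : EuclideanSpace ℝ V} (hu : u v < 0) (r : ℝ) :
    conePoint v r u v = (√2)⁻¹ * (1 - r) := by
  have : u v ≠ 0 := hu.ne
  simp only [conePoint, PiLp.add_apply, pt_apply, if_true, PiLp.smul_apply, smul_eq_mul]
  field_simp
  ring

theorem conePoint_mem_cell {v : V} {t : Finset V} (hvt : v ∈ t) {u : EuclideanSpace ℝ V}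
    (hu : u ∈ linkCell {v} t) {r : ℝ} (hr0 : 0 ≤ r) (hr1 : r ≤ 1) : conePoint v r u ∈ cell t := by
  have hneg := apply_neg_of_mem_linkCell hvt hu
  obtain ⟨-, -, h3, h4, h5⟩ :=
    (mem_linkCell_iff (Finset.singleton_nonempty v) (by simpa using hvt)).1 hu
  have hpos : 0 < -u v := neg_pos.2 hneg
  refine mem_cell_iff.2 ⟨fun w => ?_, fun w hw => ?_, ?_⟩
  · by_cases hwv : w = v
    · rw [hwv, conePoint_apply_self hneg]
      exact mul_nonneg (by positivity) (by linarith)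
    · have := h3 w (by simpa using hwv)
      simp only [conePoint, PiLp.add_apply, pt_apply, hwv, if_false, PiLp.smul_apply, smul_eq_mul,
        zero_add]
      positivity
  · have hwv : w ≠ v := by rintro rfl; exact hw hvt
    simp [conePoint, pt_apply, hwv, h4 w hw]
  · simp only [conePoint, PiLp.add_apply, PiLp.smul_apply, smul_eq_mul, Finset.sum_add_distrib,
      sum_pt, ← Finset.mul_sum, h5]
    simp

theorem exists_eq_conePoint {v : V} {t : Finset V} (hvt : v ∈ t) {y : EuclideanSpace ℝ V}
    (hy : y ∈ cell t) (hne : y ≠ pt v) :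
    ∃ r ∈ Ioc (0 : ℝ) 1, ∃ u ∈ linkCell {v} t, y = conePoint v r u := by
  obtain ⟨h1, h2, h3⟩ := mem_cell_iff.1 hy
  have hN : ‖y - pt v‖ ≠ 0 := norm_ne_zero_iff.2 (sub_ne_zero.2 hne)
  have hNpos : 0 < ‖y - pt v‖ := (norm_nonneg _).lt_of_ne' hN
  set u := ‖y - pt v‖⁻¹ • (y - pt v) with hu
  have humem : u ∈ linkCell {v} t := by
    refine (mem_linkCell_iff (Finset.singleton_nonempty v) (by simpa using hvt)).2
      ⟨?_, fun x hx z hz => ?_, fun x hx => ?_, fun x hx => ?_, ?_⟩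
    · rw [hu, norm_smul, norm_inv, norm_norm, inv_mul_cancel₀ hN]
    · rw [Finset.mem_singleton.1 hx, Finset.mem_singleton.1 hz]
    · have := h1 x
      have hxv : x ≠ v := by simpa using hx
      simp only [hu, PiLp.smul_apply, PiLp.sub_apply, pt_apply, hxv, if_false, sub_zero,
        smul_eq_mul]
      positivity
    · have hxv : x ≠ v := by rintro rfl; exact hx hvt
      simp [hu, pt_apply, hxv, h2 x hx]
    · simp only [hu, PiLp.smul_apply, PiLp.sub_apply, smul_eq_mul, ← Finset.mul_sum,
        Finset.sum_sub_distrib, h3, sum_pt, sub_self, mul_zero]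
  have hneg := apply_neg_of_mem_linkCell hvt humem
  have huv : u v = ‖y - pt v‖⁻¹ * (y v - (√2)⁻¹) := by simp [hu, pt_apply]
  have h2pos : 0 < √2 := by positivity
  have hlt : y v < (√2)⁻¹ := by
    by_contra! hle
    have := mul_nonneg (inv_pos.2 hNpos).le (sub_nonneg.2 hle)
    linarith
  -- The height obtained by solving `conePoint_apply_self` for `r`.
  refine ⟨1 - √2 * y v, ⟨?_, ?_⟩, u, humem, ?_⟩
  · have := mul_lt_mul_of_pos_left hlt h2pos
    rw [mul_inv_cancel₀ h2pos.ne'] at this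
    linarith
  · have := mul_nonneg h2pos.le (h1 v)
    linarith
  · have hd : y v - (√2)⁻¹ ≠ 0 := (sub_neg.2 hlt).ne
    have e : (1 - √2 * y v) * (√2 * -u v)⁻¹ * ‖y - pt v‖⁻¹ = 1 := by
      have hd' : 1 - √2 * y v = √2 * -(y v - (√2)⁻¹) := by field_simp; ring
      have hd'' : -(y v - (√2)⁻¹) ≠ 0 := neg_ne_zero.2 hd
      rw [huv, hd', ← mul_neg]
      generalize -(y v - (√2)⁻¹) = d at *
      field_simp
    rw [conePoint, smul_smul, hu, smul_smul, ← hu, e, one_smul, add_sub_cancel]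

theorem conePoint_injective {v : V} {r r' : ℝ} (hr : 0 < r) (hr' : 0 < r')
    {u u' : EuclideanSpace ℝ V} (hu : u v < 0) (hu' : u' v < 0) (hn : ‖u‖ = 1) (hn' : ‖u'‖ = 1)
    (h : conePoint v r u = conePoint v r' u') : u = u' := by
  rw [conePoint, conePoint, add_right_inj, smul_smul, smul_smul] at h
  have hk : 0 < r * (√2 * -u v)⁻¹ := by have := neg_pos.2 hu; positivity
  have hk' : 0 < r' * (√2 * -u' v)⁻¹ := by have := neg_pos.2 hu'; positivity
  have e := congrArg norm h
  rw [norm_smul, norm_smul, hn, hn', mul_one, mul_one, Real.norm_of_nonneg hk.le,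
    Real.norm_of_nonneg hk'.le] at e
  rw [← e] at h
  exact smul_right_injective _ hk.ne' h

variable {v : V} {p : ZMod 5 → V}

/-- The cone over a 5-cycle is a disk. -/
theorem isSimplicialDisk_cone (hp : Function.Injective p) (hv : ∀ i, p i ≠ v)
    (hL : ∀ r : Finset V, r ∈ L ↔ r.Nonempty ∧ ∃ i, r ⊆ {v, p i, p (i + 1)}) :
    IsSimplicialDisk L p := by
  have hs : ({v} : Finset V).Nonempty := Finset.singleton_nonempty v
  have hps : ∀ i, p i ∉ ({v} : Finset V) := fun i => by simpa using hv i
  have hK : ∀ r, {v} ⊆ r → (r ∈ L ↔ ∃ i, r ⊆ {v} ∪ {p i, p (i + 1)}) := fun r hr => by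
    rw [hL, and_iff_right (hs.mono hr)]
    rfl
  set ℓ : ℝ := (5 : ℕ) * edgeAngle ({v} : Finset V) with hℓ
  have hℓ0 : 0 < ℓ := by have := edgeAngle_pos hs; positivity
  have : Fact (0 < ℓ) := ⟨hℓ0⟩
  set ρ : AddCircle ℓ → EuclideanSpace ℝ V := cycleMap hs p with hρ
  have hρr : range ρ = link L {v} := range_cycleMap hs hp hps hK
  have hρmem : ∀ x, ρ x ∈ link L {v} := fun x => hρr ▸ mem_range_self x
  have hρi : Function.Injective ρ := cycleMap_injective hs hp hps
  have hρc : Continuous ρ := continuous_of_linkEDist_eq hρmem (linkEDist_cycleMap hs hp hps hK)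
  have hρcell : ∀ x, ∃ t ∈ L, v ∈ t ∧ ρ x ∈ linkCell {v} t := fun x => by
    obtain ⟨t, ht, hvt, hx⟩ := mem_link.1 (hρmem x)
    exact ⟨t, ht, by simpa using hvt, hx⟩
  have hρv : ∀ x, ρ x v < 0 := fun x => by
    obtain ⟨t, ht, hvt, hx⟩ := hρcell x
    exact apply_neg_of_mem_linkCell hvt hx
  have hρn : ∀ x, ‖ρ x‖ = 1 := fun x => norm_eq_one_of_mem_link (hρmem x)
  have hins : ∀ t ∈ L, insert v t ∈ L := by
    intro t ht
    obtain ⟨-, i, hi⟩ := (hL t).1 ht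
    exact (hL _).2 ⟨Finset.insert_nonempty _ _, i, Finset.insert_subset (by simp) hi⟩
  have hFmem : ∀ z : closedBall (0 : ℂ) 1,
      conePoint v ‖(z : ℂ)‖ (ρ (circleArg ℓ hℓ0.ne' z)) ∈ realization L := by
    intro z
    obtain ⟨t, ht, hvt, hx⟩ := hρcell (circleArg ℓ hℓ0.ne' z)
    exact mem_realization.2 ⟨t, ht, conePoint_mem_cell hvt hx (norm_nonneg _)
      (mem_closedBall_zero_iff.1 z.2)⟩
  set F : closedBall (0 : ℂ) 1 → realization L := fun z => ⟨_, hFmem z⟩ with hF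
  have hFv : ∀ z, (F z : EuclideanSpace ℝ V) v = (√2)⁻¹ * (1 - ‖(z : ℂ)‖) := fun z =>
    conePoint_apply_self (hρv _) _
  have h2 : (√2)⁻¹ ≠ 0 := by positivity
  have hFc : Continuous F := by
    refine Continuous.subtype_mk ?_ _
    set b : AddCircle ℓ → EuclideanSpace ℝ V := fun x => (√2 * -ρ x v)⁻¹ • ρ x with hb
    have hbc : Continuous b := by
      have h1 : Continuous fun x => √2 * -ρ x v := by fun_prop
      exact (h1.inv₀ fun x => mul_ne_zero (by positivity) (neg_ne_zero.2 (hρv x).ne)).smul hρc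
    -- `circleArg` need not be continuous at the origin; boundedness of `b` gives continuity there,
    -- because of the factor `‖z‖`.
    obtain ⟨C, hC⟩ := (isCompact_range hbc).isBounded.exists_norm_le
    have : Continuous fun z : ℂ => ‖z‖ • b (circleArg ℓ hℓ0.ne' z) := by
      refine continuous_iff_continuousAt.2 fun z => ?_
      by_cases hz : z = 0
      · subst hz
        refine (squeeze_zero_norm (a := fun z : ℂ => ‖z‖ * C) (fun z => ?_) ?_ :
          Filter.Tendsto _ _ _).trans (by simp)
        · rw [norm_smul, norm_norm]
          exact mul_le_mul_of_nonneg_left (hC _ (mem_range_self _)) (norm_nonneg _)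
        · have : Continuous fun z : ℂ => ‖z‖ * C := by fun_prop
          simpa using this.tendsto 0
      · exact continuous_norm.continuousAt.smul
          (hbc.continuousAt.comp (continuousAt_circleArg hℓ0.ne' hz))
    exact continuous_const.add (this.comp continuous_subtype_val)
  have hFi : Function.Injective F := by
    intro z z' h
    have hn : ‖(z : ℂ)‖ = ‖(z' : ℂ)‖ := by
      have := congrArg (fun x : realization L => (x : EuclideanSpace ℝ V) v) h
      simp only [hFv] at this
      have := mul_left_cancel₀ h2 this
      linarith
    refine Subtype.ext ?_
    by_cases h0 : (z : ℂ) = 0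
    · rw [h0, norm_zero, eq_comm, norm_eq_zero] at hn
      rw [h0, hn]
    · have hz : 0 < ‖(z : ℂ)‖ := norm_pos_iff.2 h0
      refine eq_of_norm_eq_of_circleArg_eq hℓ0.ne' hn (hρi ?_)
      exact conePoint_injective hz (hn ▸ hz) (hρv _) (hρv _) (hρn _) (hρn _)
        (congrArg Subtype.val h)
  have hFs : Function.Surjective F := by
    rintro ⟨y, hy⟩
    by_cases hyv : y = pt v
    · refine ⟨⟨0, mem_closedBall_self zero_le_one⟩, Subtype.ext ?_⟩
      simp [hF, conePoint, hyv]
    · obtain ⟨t, ht, hyt⟩ := mem_realization.1 hy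
      obtain ⟨r, ⟨hr0, hr1⟩, u, hu, e⟩ := exists_eq_conePoint (Finset.mem_insert_self v t)
        (cell_mono (Finset.subset_insert v t) hyt) hyv
      obtain ⟨x, hx⟩ : u ∈ range ρ := by
        rw [hρr]; exact mem_link.2 ⟨_, hins t ht, by simp, hu⟩
      obtain ⟨z, hz, hzx⟩ := exists_norm_circleArg hℓ0.ne' hr0 x
      refine ⟨⟨z, by rw [mem_closedBall_zero_iff, hz]; exact hr1⟩, Subtype.ext ?_⟩
      simp only [hF, hz, hzx, hx, e]
  -- A continuous bijection from the compact disk to a Hausdorff space is a homeomorphism; the disk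
  -- structure uses its inverse.
  refine ⟨fun s hs => ?_, hp, fun i => ?_,
    (hFc.homeoOfEquivCompactToT2 (f := Equiv.ofBijective F ⟨hFi, hFs⟩)).symm, fun x => ?_⟩
  · obtain ⟨-, i, hi⟩ := (hL s).1 hs
    exact (Finset.card_le_card hi).trans Finset.card_le_three
  · exact (hL _).2 ⟨Finset.insert_nonempty _ _, i, Finset.subset_insert _ _⟩
  · obtain ⟨z, rfl⟩ := hFs x
    have e : (hFc.homeoOfEquivCompactToT2 (f := Equiv.ofBijective F ⟨hFi, hFs⟩)).symm (F z) = z :=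
      (hFc.homeoOfEquivCompactToT2 (f := Equiv.ofBijective F ⟨hFi, hFs⟩)).symm_apply_apply z
    rw [e]
    have e' : ‖(z : ℂ)‖ = 1 ↔ (F z : EuclideanSpace ℝ V) v = 0 := by
      rw [hFv, mul_eq_zero, or_iff_right h2, sub_eq_zero, eq_comm]
    rw [e']
    constructor
    · intro h0
      obtain ⟨t, ht, hx⟩ := mem_realization.1 (F z).2
      obtain ⟨-, i, hi⟩ := (hL t).1 ht
      obtain ⟨g1, g2, g3⟩ := mem_cell_iff.1 (cell_mono hi hx)
      refine ⟨i, mem_cell_iff.2 ⟨g1, fun w hw => ?_, g3⟩⟩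
      by_cases hwv : w = v
      · rw [hwv, h0]
      · exact g2 w (by rw [Finset.mem_insert]; exact not_or.2 ⟨hwv, hw⟩)
    · rintro ⟨i, hi⟩
      exact (mem_cell_iff.1 hi).2.1 v (by simp [(hv _).symm])

end ConeDisk

/-! ### Combinatorics of the cone over a 5-cycle -/

section ConeCycle

variable {V W : Type*} [DecidableEq V] [DecidableEq W]

/-- The cone with apex `v` over the 5-cycle `p`. -/
def coneCycle (v : V) (p : ZMod 5 → V) : PreAbstractSimplicialComplex V where
  faces := {r | r.Nonempty ∧ ∃ i, r ⊆ {v, p i, p (i + 1)}}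
  isRelLowerSet_faces := fun {_} ⟨hs, i, hi⟩ => ⟨hs, fun _ hts ht => ⟨ht, i, hts.trans hi⟩⟩

theorem mem_coneCycle {v : V} {p : ZMod 5 → V} {r : Finset V} :
    r ∈ coneCycle v p ↔ r.Nonempty ∧ ∃ i, r ⊆ {v, p i, p (i + 1)} := Iff.rfl

theorem map_coneCycle (v : V) (p : ZMod 5 → V) (f : V → W) :
    (coneCycle v p).map f = coneCycle (f v) (f ∘ p) := by
  refine SetLike.ext fun r => ?_
  constructor
  · rintro ⟨s, ⟨hs, i, hi⟩, rfl⟩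
    refine ⟨hs.image f, i, (Finset.image_subset_image hi).trans ?_⟩
    simp [Finset.image_insert]
  · rintro ⟨hr, i, hi⟩
    have e : ({f v, (f ∘ p) i, (f ∘ p) (i + 1)} : Finset W) =
      ({v, p i, p (i + 1)} : Finset V).image f := by simp [Finset.image_insert]
    rw [e] at hi
    obtain ⟨s, hs, rfl⟩ := Finset.subset_image_iff.1 hi
    exact ⟨s, ⟨Finset.image_nonempty.1 hr, i, by simpa using hs⟩, rfl⟩

theorem singleton_mem_coneCycle {v w : V} {p : ZMod 5 → V} :
    {w} ∈ coneCycle v p ↔ w = v ∨ w ∈ range p := by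
  simp only [mem_coneCycle, Finset.singleton_nonempty, true_and, Finset.singleton_subset_iff,
    Finset.mem_insert, Finset.mem_singleton, mem_range]
  constructor
  · rintro ⟨i, h | h | h⟩
    · exact Or.inl h
    · exact Or.inr ⟨_, h.symm⟩
    · exact Or.inr ⟨_, h.symm⟩
  · rintro (h | ⟨i, rfl⟩)
    · exact ⟨0, Or.inl h⟩
    · exact ⟨i, Or.inr (Or.inl rfl)⟩

variable {v : V} {p : ZMod 5 → V} (hp : Function.Injective p) (hv : ∀ i, p i ≠ v)

include hp hv

theorem card_coneCycle_triangle (i : ZMod 5) : ({v, p i, p (i + 1)} : Finset V).card = 3 := by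
  have h1 : ∀ z : ZMod 5, z ≠ z + 1 := by decide
  rw [Finset.card_eq_three]
  exact ⟨_, _, _, (hv _).symm, (hv _).symm, fun h => h1 i (hp h), rfl⟩

theorem coneCycle_triangle_injective :
    Function.Injective fun i => ({v, p i, p (i + 1)} : Finset V) := by
  intro i j hij
  have hmem : ∀ i k, p k ∈ ({v, p i, p (i + 1)} : Finset V) ↔ k = i ∨ k = i + 1 := by
    intro i k
    simp [hv, hp.eq_iff]
  have hij' : ({v, p i, p (i + 1)} : Finset V) = {v, p j, p (j + 1)} := hij
  have h1 := (hmem j i).1 (hij' ▸ (hmem i i).2 (Or.inl rfl))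
  have h2 := (hmem j (i + 1)).1 (hij' ▸ (hmem i (i + 1)).2 (Or.inr rfl))
  -- An edge of the 5-cycle determines its initial vertex.
  have h : ∀ i j : ZMod 5, i = j ∨ i = j + 1 → i + 1 = j ∨ i + 1 = j + 1 → i = j := by decide
  exact h i j h1 h2

theorem coneCycle_triangles :
    {s | s ∈ coneCycle v p ∧ s.card = 3} = range fun i => ({v, p i, p (i + 1)} : Finset V) := by
  ext s
  constructor
  · rintro ⟨⟨-, i, hi⟩, hs⟩
    exact ⟨i, (Finset.eq_of_subset_of_card_le hi
      (by rw [card_coneCycle_triangle hp hv, hs])).symm⟩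
  · rintro ⟨i, rfl⟩
    exact ⟨⟨Finset.insert_nonempty _ _, i, subset_rfl⟩, card_coneCycle_triangle hp hv i⟩

theorem ncard_coneCycle_triangles : {s | s ∈ coneCycle v p ∧ s.card = 3}.ncard = 5 := by
  rw [coneCycle_triangles hp hv, ← image_univ,
    ncard_image_of_injective _ (coneCycle_triangle_injective hp hv), ncard_univ, Nat.card_zmod]

theorem isSimplicialDisk_coneCycle [Fintype V] : IsSimplicialDisk (coneCycle v p) p :=
  isSimplicialDisk_cone hp hv fun _ => mem_coneCycle

end ConeCycle

/-! ### The join: links, CAT(0), and the full subcomplexes -/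

section PentagonJoin

variable {n : ℕ}

theorem card_core (n : ℕ) : (core n).card = n - 1 := by simp [core]

theorem inr_mem_topSimplex {i j : ZMod 5} : Sum.inr j ∈ topSimplex n i ↔ j = i ∨ j = i + 1 := by
  simp [topSimplex, core, pentagon]

theorem inl_mem_topSimplex {i : ZMod 5} (v : Fin (n - 1)) : Sum.inl v ∈ topSimplex n i := by
  simp [topSimplex, core]

/-- Every set of vertices of σ is allowed, so only the part in the 5-cycle is constrained. -/
theorem mem_pentagonJoin {s : Finset (Fin (n - 1) ⊕ ZMod 5)} :
    s ∈ pentagonJoin n ↔ s.Nonempty ∧ ∃ i, s ⊆ topSimplex n i := by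
  have key : ∀ i, s ⊆ topSimplex n i ↔ s.toRight ⊆ {i, i + 1} := by
    intro i
    constructor
    · intro h j hj
      have := inr_mem_topSimplex.1 (h (Finset.mem_toRight.1 hj))
      simpa using this
    · rintro h (v | j) hx
      · exact inl_mem_topSimplex v
      · exact inr_mem_topSimplex.2 (by simpa using h (Finset.mem_toRight.2 hx))
  simp only [key]
  constructor
  · rintro ⟨hs, -, h⟩
    refine ⟨hs, ?_⟩
    rcases h with h | ⟨-, i, hi⟩
    · exact ⟨0, by simp [h]⟩
    · exact ⟨i, hi⟩
  · rintro ⟨hs, i, hi⟩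
    refine ⟨hs, ?_, ?_⟩
    · rcases Finset.eq_empty_or_nonempty s.toLeft with h | h
      · exact Or.inl h
      · exact Or.inr h
    · rcases Finset.eq_empty_or_nonempty s.toRight with h | h
      · exact Or.inl h
      · exact Or.inr ⟨h, i, hi⟩

theorem card_topSimplex (hn : 1 ≤ n) (i : ZMod 5) : (topSimplex n i).card = n + 1 := by
  have h1 : ∀ z : ZMod 5, z ≠ z + 1 := by decide
  rw [topSimplex, Finset.card_union_of_disjoint, card_core, Finset.card_pair]
  · omega
  · simpa [pentagon] using h1 i
  · simp [core, pentagon, Finset.disjoint_left]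

theorem topSimplex_mem (i : ZMod 5) : topSimplex n i ∈ pentagonJoin n :=
  mem_pentagonJoin.2 ⟨⟨Sum.inr i, inr_mem_topSimplex.2 (Or.inl rfl)⟩, i, subset_rfl⟩

theorem card_le_of_mem_pentagonJoin (hn : 1 ≤ n) {s : Finset (Fin (n - 1) ⊕ ZMod 5)}
    (hs : s ∈ pentagonJoin n) : s.card ≤ n + 1 := by
  obtain ⟨-, i, hi⟩ := mem_pentagonJoin.1 hs
  exact card_topSimplex hn i ▸ Finset.card_le_card hi

theorem core_nonempty (hn : 2 ≤ n) : (core n).Nonempty := by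
  rw [← Finset.card_pos, card_core]; omega

theorem core_subset_topSimplex (i : ZMod 5) : core n ⊆ topSimplex n i := Finset.subset_union_left

theorem pentagon_injective : Function.Injective (pentagon n) := Sum.inr_injective

/-- The join is a cone with apex any vertex of σ. This drives both the absence of loops in most
links and contractibility. -/
theorem insert_mem_pentagonJoin {w : Fin (n - 1) ⊕ ZMod 5} (hw : w ∈ core n)
    {t : Finset (Fin (n - 1) ⊕ ZMod 5)} (ht : t ∈ pentagonJoin n) :
    insert w t ∈ pentagonJoin n := by
  obtain ⟨-, i, hi⟩ := mem_pentagonJoin.1 ht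
  exact mem_pentagonJoin.2
    ⟨Finset.insert_nonempty _ _, i, Finset.insert_subset (core_subset_topSimplex i hw) hi⟩

theorem linkIsCycle_core (hn : 2 ≤ n) :
    LinkIsCycle (pentagonJoin n) (core n) 5 (arccos (1 / n)) (topSimplex n) := by
  have h := linkIsCycle (K := pentagonJoin n) (core_nonempty hn) pentagon_injective
    (fun i => by simp [core, pentagon])
    (fun r hr => by
      rw [mem_pentagonJoin, and_iff_right ((core_nonempty hn).mono hr)]
      rfl) (t := topSimplex n) fun i => rfl
  have e : ((n - 1 : ℕ) : ℝ) + 1 = n := by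
    rw [Nat.cast_sub (by omega)]; simp
  rwa [edgeAngle, card_core, e] at h

/-- Either `s` properly contains σ and has codimension at most one, or it misses a vertex of σ and
the cone argument applies. -/
theorem not_isLocallyGeodesicLoop_of_ne_core (hn : 2 ≤ n) {s : Finset (Fin (n - 1) ⊕ ZMod 5)}
    (hs : s ∈ pentagonJoin n) (hne : s ≠ core n) {ℓ : ℝ}
    (ρ : AddCircle ℓ → EuclideanSpace ℝ (Fin (n - 1) ⊕ ZMod 5)) :
    ¬ IsLocallyGeodesicLoop (pentagonJoin n) s ℓ ρ := by
  have hs0 := (mem_pentagonJoin.1 hs).1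
  by_cases h : core n ⊆ s
  · refine not_isLocallyGeodesicLoop_of_card_le hs0 (fun t ht _ => ?_) ρ
    have h1 := Finset.card_lt_card (Finset.ssubset_iff_subset_ne.2 ⟨h, hne.symm⟩)
    have h2 := card_le_of_mem_pentagonJoin (by omega) ht
    rw [card_core] at h1
    omega
  · obtain ⟨w, hw, hws⟩ := Finset.not_subset.1 h
    exact not_isLocallyGeodesicLoop_of_cone hs0 hws
      (fun t ht => insert_mem_pentagonJoin hw ht) ρ

/-- `cos (2π/5) = (√5 - 1) / 4` exceeds `1 / 4` because `√5 > 2`; this is where `n ≥ 4` enters. -/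
theorem two_pi_lt_five_mul_arccos (hn : 4 ≤ n) : 2 * π < 5 * arccos (1 / n) := by
  have h5 : cos (2 * π / 5) = (√5 - 1) / 4 := by
    have h : 2 * π / 5 = 2 * (π / 5) := by ring
    have hs : √5 ^ 2 = 5 := sq_sqrt (by norm_num)
    rw [h, cos_two_mul, cos_pi_div_five]
    linear_combination hs / 8
  have hlt : (1 : ℝ) / n < cos (2 * π / 5) := by
    have h1 : (1 : ℝ) / n ≤ 1 / 4 := by
      have : (4 : ℝ) ≤ n := by exact_mod_cast hn
      exact one_div_le_one_div_of_le (by norm_num) this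
    have h2 : (2 : ℝ) < √5 := lt_sqrt_of_sq_lt (by norm_num)
    rw [h5]
    linarith
  have h0 : (0 : ℝ) ≤ 1 / n := by positivity
  have := arccos_lt_arccos (by linarith) hlt (cos_le_one _)
  rw [arccos_cos (by positivity) (by linarith [pi_pos])] at this
  linarith

theorem starConvex_realization {V : Type*} [Fintype V] [DecidableEq V]
    {K : PreAbstractSimplicialComplex V} {w : V} (hw : ∀ t ∈ K, insert w t ∈ K) :
    StarConvex ℝ (pt w) (realization K) := by
  intro x hx a b ha hb hab
  obtain ⟨t, ht, hxt⟩ := mem_realization.1 hx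
  exact mem_realization.2 ⟨_, hw t ht, (convex_convexHull ℝ _)
    (subset_convexHull ℝ _ (mem_image_of_mem pt (Finset.mem_coe.2 (Finset.mem_insert_self w t))))
    (cell_mono (Finset.subset_insert w t) hxt) ha hb hab⟩

theorem isCAT0_pentagonJoin (hn : 4 ≤ n) : IsCAT0 (pentagonJoin n) := by
  obtain ⟨w, hw⟩ := core_nonempty (n := n) (by omega)
  have : ContractibleSpace (realization (pentagonJoin n)) :=
    (starConvex_realization fun t ht => insert_mem_pentagonJoin hw ht).contractibleSpace
      ⟨pt w, mem_realization.2 ⟨topSimplex n 0, topSimplex_mem 0,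
        subset_convexHull ℝ _ (mem_image_of_mem pt (core_subset_topSimplex 0 hw))⟩⟩
  refine ⟨fun s hs ℓ ρ hρ => ?_, inferInstance, SimplyConnectedSpace.ofContractible _⟩
  by_cases h : s = core n
  · subst h
    have := (linkIsCycle_core (by omega)).le_of_isLocallyGeodesicLoop (by norm_num) hρ
    have h2 := two_pi_lt_five_mul_arccos hn
    push_cast at this
    linarith
  · exact absurd hρ (not_isLocallyGeodesicLoop_of_ne_core (by omega) hs h ρ)

theorem coneDisk_eq (n : ℕ) (v : Fin (n - 1)) :
    coneDisk n v = coneCycle (Sum.inl v) (pentagon n) := by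
  refine SetLike.ext fun r => ?_
  constructor
  · rintro ⟨hr, hsub⟩
    obtain ⟨hne, i, hi⟩ := mem_pentagonJoin.1 hr
    refine ⟨hne, i, fun x hx => ?_⟩
    rcases hsub hx with h | ⟨j, rfl⟩
    · simp [mem_singleton_iff.1 h]
    · have := inr_mem_topSimplex.1 (hi hx)
      simpa [pentagon] using this
  · rintro ⟨hne, i, hi⟩
    refine ⟨mem_pentagonJoin.2 ⟨hne, i, fun x hx => ?_⟩, fun x hx => ?_⟩
    · have := hi hx
      simp only [Finset.mem_insert, Finset.mem_singleton] at this
      rcases this with rfl | rfl | rfl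
      · exact inl_mem_topSimplex v
      · exact inr_mem_topSimplex.2 (Or.inl rfl)
      · exact inr_mem_topSimplex.2 (Or.inr rfl)
    · have := hi hx
      simp only [Finset.mem_insert, Finset.mem_singleton] at this
      rcases this with rfl | rfl | rfl
      · exact Or.inl rfl
      · exact Or.inr ⟨_, rfl⟩
      · exact Or.inr ⟨_, rfl⟩

theorem linkIsCycle_coneDisk (v : Fin (n - 1)) :
    LinkIsCycle (coneDisk n v) {Sum.inl v} 5 (π / 3) (coneTriangle n v) := by
  have h := linkIsCycle (K := coneDisk n v) (Finset.singleton_nonempty (Sum.inl v))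
    (pentagon_injective (n := n)) (fun i => by simp [pentagon])
    (fun r hr => by
      rw [coneDisk_eq, mem_coneCycle, and_iff_right ((Finset.singleton_nonempty _).mono hr)]
      rfl) (t := coneTriangle n v) fun i => rfl
  have e : edgeAngle ({Sum.inl v} : Finset (Fin (n - 1) ⊕ ZMod 5)) = π / 3 := by
    rw [edgeAngle, Finset.card_singleton,
      show (1 : ℝ) / ((1 : ℕ) + 1) = cos (π / 3) by rw [cos_pi_div_three]; norm_num,
      arccos_cos (by positivity) (by linarith [pi_pos])]
  rwa [e] at h

theorem not_isNPC_coneDisk (v : Fin (n - 1)) : ¬ IsNPC (coneDisk n v) := by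
  intro h
  obtain ⟨ρ, hρ⟩ := (linkIsCycle_coneDisk v).exists_isLocallyGeodesicLoop (by norm_num)
  have := h {Sum.inl v} (by rw [coneDisk_eq, singleton_mem_coneCycle]; exact Or.inl rfl) _ ρ hρ
  push_cast at this
  linarith [pi_pos]

theorem isFull_coneDisk (v : Fin (n - 1)) : IsFull (coneDisk n v) (pentagonJoin n) := by
  refine ⟨fun s hs => hs.1, fun s hs h => ⟨hs, fun x hx => ?_⟩⟩
  have := (h x hx).2
  simpa using this

theorem not_fullSubcomplexesAreNPC (hn : 4 ≤ n)
    (hdim : HasDim (pentagonJoin n) n) : ¬ FullSubcomplexesAreNPC n := by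
  intro h
  have v : Fin (n - 1) := ⟨0, by omega⟩
  exact not_isNPC_coneDisk v (h _ _ _ hdim (isCAT0_pentagonJoin hn) (isFull_coneDisk v))

theorem coneDisk_injective : Function.Injective (coneDisk n) := by
  intro v w h
  have : {Sum.inl v} ∈ coneDisk n w := by
    rw [← h, coneDisk_eq, singleton_mem_coneCycle]; exact Or.inl rfl
  rw [coneDisk_eq, singleton_mem_coneCycle] at this
  simpa [pentagon] using this

end PentagonJoin

/-! ### Minimal spanning disks are cones -/

section SpanningDisks

variable {n : ℕ}

/-- The boundary vertices of the cone over a 5-cycle with vertices numbered from `0` to `5`. -/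
def rim (i : ZMod 5) : Fin 6 := Fin.castSucc (n := 5) i

theorem rim_injective : Function.Injective rim := Fin.castSucc_injective 5

theorem rim_ne_last (i : ZMod 5) : rim i ≠ Fin.last 5 := Fin.castSucc_ne_last (n := 5) i

/-- The map of the cone over a 5-cycle to the join that sends the apex to `v`. -/
def coneMap (n : ℕ) (v : Fin (n - 1)) : Fin 6 → Fin (n - 1) ⊕ ZMod 5 :=
  Fin.lastCases (n := 5) (Sum.inl v) fun i => Sum.inr i

theorem coneMap_last (v : Fin (n - 1)) : coneMap n v (Fin.last 5) = Sum.inl v :=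
  Fin.lastCases_last

theorem coneMap_rim (v : Fin (n - 1)) (i : ZMod 5) : coneMap n v (rim i) = pentagon n i :=
  Fin.lastCases_castSucc (n := 5) i

theorem map_coneMap (v : Fin (n - 1)) :
    (coneCycle (Fin.last 5) rim).map (coneMap n v) = coneDisk n v := by
  rw [map_coneCycle, coneMap_last, coneDisk_eq]
  congr 1
  exact funext (coneMap_rim v)

/-- The disk of five triangles through the vertex `v` of the core. -/
def spanningConeDisk (n : ℕ) (v : Fin (n - 1)) :
    SpanningDisk (pentagonJoin n) (pentagon n) where
  size := 6
  diagram := coneCycle (Fin.last 5) rim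
  bdry := rim
  isDisk := isSimplicialDisk_coneCycle rim_injective rim_ne_last
  toFun := coneMap n v
  map_mem := by
    intro s hs
    have h : s.image (coneMap n v) ∈ (coneCycle (Fin.last 5) rim).map (coneMap n v) :=
      ⟨s, hs, rfl⟩
    rw [map_coneMap] at h
    exact h.1
  map_bdry := coneMap_rim v

theorem spanningConeDisk_image (v : Fin (n - 1)) :
    (spanningConeDisk n v).image = coneDisk n v :=
  map_coneMap v

theorem spanningConeDisk_area (v : Fin (n - 1)) : (spanningConeDisk n v).area = 5 :=
  ncard_coneCycle_triangles rim_injective rim_ne_last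

variable (D : SpanningDisk (pentagonJoin n) (pentagon n))

/-- The image of `s` is a simplex of the join, which meets the 5-cycle in at most an edge. -/
theorem SpanningDisk.eq_or_eq_of_bdry_mem {s : Finset (Fin D.size)} (hs : s ∈ D.diagram)
    {i k : ZMod 5} (hi : D.bdry i ∈ s) (hi' : D.bdry (i + 1) ∈ s) (hk : D.bdry k ∈ s) :
    k = i ∨ k = i + 1 := by
  obtain ⟨-, m, hm⟩ := mem_pentagonJoin.1 (D.map_mem s hs)
  have key : ∀ j, D.bdry j ∈ s → j = m ∨ j = m + 1 := by
    intro j hj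
    have := hm (Finset.mem_image_of_mem D.toFun hj)
    rw [D.map_bdry] at this
    exact inr_mem_topSimplex.1 this
  have h : ∀ i k m : ZMod 5, (i = m ∨ i = m + 1) → (i + 1 = m ∨ i + 1 = m + 1) →
    (k = m ∨ k = m + 1) → k = i ∨ k = i + 1 := by decide
  exact h i k m (key i hi) (key _ hi') (key k hk)

/-- The triangles on the five boundary edges are distinct. -/
theorem SpanningDisk.exists_boundary_triangles :
    ∃ T : ZMod 5 → Finset (Fin D.size), Function.Injective T ∧
      ∀ i, T i ∈ D.diagram ∧ (T i).card = 3 ∧ D.bdry i ∈ T i ∧ D.bdry (i + 1) ∈ T i := by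
  obtain ⟨hcard, -, hedge, h, -⟩ := D.isDisk
  choose T hT hsub hT3 using fun i => exists_triangle hcard h (hedge i)
  have hi : ∀ i, D.bdry i ∈ T i := fun i => hsub i (by simp)
  have hi' : ∀ i, D.bdry (i + 1) ∈ T i := fun i => hsub i (by simp)
  refine ⟨T, fun i j hij => ?_, fun i => ⟨hT i, hT3 i, hi i, hi' i⟩⟩
  have h1 := D.eq_or_eq_of_bdry_mem (hT j) (hi j) (hi' j) (hij ▸ hi i)
  have h2 := D.eq_or_eq_of_bdry_mem (hT j) (hi j) (hi' j) (hij ▸ hi' i)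
  have h : ∀ i j : ZMod 5, i = j ∨ i = j + 1 → i + 1 = j ∨ i + 1 = j + 1 → i = j := by decide
  exact h i j h1 h2

theorem ncard_range_of_injective {α : Type*} {T : ZMod 5 → α} (hT : Function.Injective T) :
    (range T).ncard = 5 := by
  rw [← image_univ, ncard_image_of_injective _ hT, ncard_univ, Nat.card_zmod]

theorem SpanningDisk.five_le_area : 5 ≤ D.area := by
  obtain ⟨T, hTi, hT⟩ := D.exists_boundary_triangles
  refine (ncard_range_of_injective hTi).ge.trans (ncard_le_ncard ?_ (Set.toFinite _))
  rintro _ ⟨i, rfl⟩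
  exact ⟨(hT i).1, (hT i).2.1⟩

theorem spanningConeDisk_isMinimal (v : Fin (n - 1)) : (spanningConeDisk n v).IsMinimal :=
  fun D => by rw [spanningConeDisk_area]; exact D.five_le_area

/-- A spanning disk of area five is a cone over its boundary, with apex over the core. -/
theorem SpanningDisk.exists_eq_coneCycle (harea : D.area = 5) :
    ∃ x v, x ∉ range D.bdry ∧ D.toFun x = Sum.inl v ∧ D.diagram = coneCycle x D.bdry := by
  obtain ⟨T, hTi, hT⟩ := D.exists_boundary_triangles
  obtain ⟨hcard, hb, hedge, h, hh⟩ := D.isDisk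
  -- Area five leaves no triangle besides the boundary ones.
  have htri : range T = {s | s ∈ D.diagram ∧ s.card = 3} := by
    refine Set.eq_of_subset_of_ncard_le ?_ ?_ (Set.toFinite _)
    · rintro _ ⟨i, rfl⟩
      exact ⟨(hT i).1, (hT i).2.1⟩
    · rw [ncard_range_of_injective hTi]
      exact harea.le
  have hne : ∀ z : ZMod 5, z ≠ z + 1 := by decide
  have hx : ∀ i, ∃ x, x ∉ range D.bdry ∧ T i = {x, D.bdry i, D.bdry (i + 1)} := by
    intro i
    obtain ⟨h1, h2, h3, h4⟩ := hT i
    obtain ⟨x, hxT, hx⟩ := Finset.exists_mem_notMem_of_card_lt_card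
      (s := {D.bdry i, D.bdry (i + 1)}) (t := T i)
      (by rw [h2]; exact Finset.card_le_two.trans_lt (by norm_num))
    simp only [Finset.mem_insert, Finset.mem_singleton, not_or] at hx
    refine ⟨x, ?_, (Finset.eq_of_subset_of_card_le ?_ ?_).symm⟩
    · rintro ⟨k, rfl⟩
      rcases D.eq_or_eq_of_bdry_mem h1 h3 h4 hxT with rfl | rfl
      · exact hx.1 rfl
      · exact hx.2 rfl
    · simp [Finset.insert_subset_iff, hxT, h3, h4]
    · rw [h2, Finset.card_eq_three.2 ⟨_, _, _, hx.1, hx.2, fun e => hne i (hb e), rfl⟩]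
  choose x hxb hxT using hx
  have hstep : ∀ i, x i = x (i + 1) := by
    intro i
    obtain ⟨h1, h2, h3, h4⟩ := hT i
    have hxi : x i ∈ T i := by rw [hxT]; simp
    set e : Finset (Fin D.size) := {D.bdry (i + 1), x i} with he
    have heT : e ⊆ T i := by simp [he, Finset.insert_subset_iff, h4, hxi]
    have heD : e ∈ D.diagram :=
      (D.diagram.isRelLowerSet_faces h1).2 heT (Finset.insert_nonempty _ _)
    -- Otherwise the interior of the edge `e` would lie on the boundary circle, making `x i` a
    -- boundary vertex.
    obtain ⟨r, hr, her, hrT⟩ : ∃ r ∈ D.diagram, e ⊆ r ∧ ¬ r ⊆ T i := by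
      by_contra! hcon
      obtain ⟨p, hp, hpos⟩ := exists_mem_cell_pos (s := e) (Finset.insert_nonempty _ _)
      have hie : D.bdry i ∉ e := by
        simp only [he, Finset.mem_insert, Finset.mem_singleton, not_or]
        exact ⟨fun e => hne i (hb e), fun e => hxb i ⟨i, e⟩⟩
      have hn := norm_eq_one_of_unique_triangle h h1 h3 hie hcon
        ⟨p, mem_realization.2 ⟨e, heD, hp⟩⟩ hp hpos
      obtain ⟨j, hj⟩ := (hh _).1 hn
      have := subset_of_mem_cell hj hpos (show x i ∈ e by simp [he])
      simp only [Finset.mem_insert, Finset.mem_singleton] at this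
      rcases this with h | h <;> exact hxb i ⟨_, h.symm⟩
    obtain ⟨t, ht, hrt, ht3⟩ := exists_triangle hcard h hr
    obtain ⟨j, rfl⟩ : t ∈ range T := by rw [htri]; exact ⟨ht, ht3⟩
    have hji : j ≠ i := by rintro rfl; exact hrT hrt
    have hbj := D.eq_or_eq_of_bdry_mem ht (hT j).2.2.1 (hT j).2.2.2
      (hrt (her (show D.bdry (i + 1) ∈ e by simp [he])))
    -- The second triangle on `e` contains `D.bdry (i + 1)`, and only the boundary triangles `i` and
    -- `i + 1` do.
    have hj : j = i + 1 := by
      rcases hbj with h | h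
      · exact h.symm
      · exact absurd (add_right_cancel h).symm hji
    have hxj := hrt (her (show x i ∈ e by simp [he]))
    rw [hxT, hj] at hxj
    simp only [Finset.mem_insert, Finset.mem_singleton] at hxj
    rcases hxj with h | h | h
    · exact h
    · exact absurd ⟨_, h.symm⟩ (hxb i)
    · exact absurd ⟨_, h.symm⟩ (hxb i)
  have hconst : ∀ i, x i = x 0 := by
    have : ∀ k : ℕ, x (k : ZMod 5) = x 0 := by
      intro k
      induction k with
      | zero => simp
      | succ k ih => rw [Nat.cast_succ, ← hstep, ih]
    intro i
    rw [← ZMod.natCast_zmod_val i]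
    exact this _
  have hT' : ∀ i, T i = {x 0, D.bdry i, D.bdry (i + 1)} := fun i => by rw [hxT, hconst]
  obtain ⟨v, hv⟩ : ∃ v, D.toFun (x 0) = Sum.inl v := by
    rcases hfx : D.toFun (x 0) with v | j
    · exact ⟨v, rfl⟩
    · exfalso
      -- If the apex went to the vertex `j` of the 5-cycle, the triangle `T (j + 2)` would join `j`
      -- to the nonadjacent vertex `j + 2`.
      obtain ⟨-, m, hm⟩ := mem_pentagonJoin.1 (D.map_mem _ (hT (j + 2)).1)
      have key : ∀ y ∈ T (j + 2), ∀ k, D.toFun y = Sum.inr k → k = m ∨ k = m + 1 := by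
        intro y hy k hk
        have := hm (Finset.mem_image_of_mem D.toFun hy)
        rw [hk] at this
        exact inr_mem_topSimplex.1 this
      have k1 := key _ (by rw [hT']; simp) _ hfx
      have k2 := key _ (hT (j + 2)).2.2.1 _ (D.map_bdry _)
      have k3 := key _ (hT (j + 2)).2.2.2 _ (D.map_bdry _)
      have : ∀ j m : ZMod 5, (j = m ∨ j = m + 1) → (j + 2 = m ∨ j + 2 = m + 1) → False := by decide
      exact this j m k1 k2
  refine ⟨x 0, v, hxb 0, hv, SetLike.ext fun s => ⟨fun hs => ?_, ?_⟩⟩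
  · obtain ⟨t, ht, hst, ht3⟩ := exists_triangle hcard h hs
    obtain ⟨i, rfl⟩ : t ∈ range T := by rw [htri]; exact ⟨ht, ht3⟩
    exact ⟨(D.diagram.isRelLowerSet_faces hs).1, i, hT' i ▸ hst⟩
  · rintro ⟨hs, i, hi⟩
    exact (D.diagram.isRelLowerSet_faces (hT i).1).2 (hT' i ▸ hi) hs

variable {D}

theorem SpanningDisk.IsMinimal.exists_eq_coneCycle (hn : 2 ≤ n) (hD : D.IsMinimal) :
    ∃ x v, x ∉ range D.bdry ∧ D.toFun x = Sum.inl v ∧ D.diagram = coneCycle x D.bdry := by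
  have v : Fin (n - 1) := ⟨0, by omega⟩
  refine D.exists_eq_coneCycle (le_antisymm ?_ D.five_le_area)
  exact (hD _).trans (spanningConeDisk_area v).le

theorem SpanningDisk.IsMinimal.exists_image_eq (hn : 2 ≤ n) (hD : D.IsMinimal) :
    ∃ v, coneDisk n v = D.image := by
  obtain ⟨x, v, -, hv, hdiag⟩ := hD.exists_eq_coneCycle hn
  refine ⟨v, ?_⟩
  rw [SpanningDisk.image, hdiag, map_coneCycle, hv, coneDisk_eq]
  congr 1
  exact (funext D.map_bdry).symm

/-- The apex goes to σ, the rim bijectively to the 5-cycle, and these are disjoint. -/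
theorem SpanningDisk.IsMinimal.injOn (hn : 2 ≤ n) (hD : D.IsMinimal) :
    InjOn D.toFun {w | {w} ∈ D.diagram} := by
  obtain ⟨x, v, -, hv, hdiag⟩ := hD.exists_eq_coneCycle hn
  have key : ∀ w, {w} ∈ D.diagram → w = x ∨ w ∈ range D.bdry := fun w hw => by
    rwa [hdiag, singleton_mem_coneCycle] at hw
  intro w hw w' hw' e
  rcases key w hw with rfl | ⟨i, rfl⟩ <;> rcases key w' hw' with rfl | ⟨j, rfl⟩
  · rfl
  · rw [hv, D.map_bdry] at e
    cases e
  · rw [hv, D.map_bdry] at e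
    cases e
  · rw [D.map_bdry, D.map_bdry] at e
    rw [pentagon_injective e]

theorem isEmptyPolygon_pentagon (hn : 2 ≤ n) : IsEmptyPolygon (pentagonJoin n) (pentagon n) := by
  have v : Fin (n - 1) := ⟨0, by omega⟩
  refine ⟨pentagon_injective, fun i => ?_, ⟨_, spanningConeDisk_isMinimal v⟩, fun D hD => ?_⟩
  · exact mem_pentagonJoin.2 ⟨Finset.insert_nonempty _ _, i, Finset.subset_union_right⟩
  · obtain ⟨x, v, hx, -, hdiag⟩ := hD.exists_eq_coneCycle hn
    exact ⟨x, by rw [hdiag, singleton_mem_coneCycle]; exact Or.inl rfl, hx⟩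

end SpanningDisks

end PECurvature

/-! ### The high-dimensional empty pentagon -/

theorem mainTheorem5 (n : ℕ) (hn : 4 ≤ n) :
    -- the join is an `n`-complex, the union of five distinct `n`-simplices arranged around `σ`
    (HasDim (pentagonJoin n) n ∧ core n ∈ pentagonJoin n ∧ (core n).card = n - 1 ∧
      Function.Injective (topSimplex n) ∧
      {s | s ∈ pentagonJoin n ∧ s.card = n + 1} = range (topSimplex n) ∧
      ∀ s ∈ pentagonJoin n, ∃ i, s ⊆ topSimplex n i) ∧
    -- the link of `σ` is a cycle of five edges of length `arccos (1 / n)`, longer than `2π`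
    LinkIsCycle (pentagonJoin n) (core n) 5 (arccos (1 / n)) (topSimplex n) ∧
    2 * π < 5 * arccos (1 / n) ∧
    -- the curvature depends only on the link of `σ`
    (∀ s ∈ pentagonJoin n, s ≠ core n → ∀ (ℓ : ℝ) (ρ : AddCircle ℓ → EuclideanSpace ℝ _),
      ¬ IsLocallyGeodesicLoop (pentagonJoin n) s ℓ ρ) ∧
    -- the join is CAT(0)
    IsCAT0 (pentagonJoin n) ∧
    -- the 5-cycle is an empty pentagon, and there are `n - 1` minimal disks spanning it, one
    -- through each vertex of `σ`, all of them embedded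
    IsEmptyPolygon (pentagonJoin n) (pentagon n) ∧
    {L | ∃ D : SpanningDisk (pentagonJoin n) (pentagon n), D.IsMinimal ∧ D.image = L} =
      range (coneDisk n) ∧
    (range (coneDisk n)).ncard = n - 1 ∧
    (∀ D : SpanningDisk (pentagonJoin n) (pentagon n), D.IsMinimal →
      InjOn D.toFun {w | {w} ∈ D.diagram}) ∧
    -- each of these is a full subcomplex, a disk of five triangles around one interior vertex,
    -- whose link is a circle of length `5π/3 < 2π`; so it is not nonpositively curved
    (∀ v : Fin (n - 1),
      IsFull (coneDisk n v) (pentagonJoin n) ∧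
      IsSimplicialDisk (coneDisk n v) (pentagon n) ∧
      (∀ w, {w} ∈ coneDisk n v ↔ w = Sum.inl v ∨ w ∈ range (pentagon n)) ∧
      Function.Injective (coneTriangle n v) ∧
      {s | s ∈ coneDisk n v ∧ s.card = 3} = range (coneTriangle n v) ∧
      LinkIsCycle (coneDisk n v) {Sum.inl v} 5 (π / 3) (coneTriangle n v) ∧
      5 * (π / 3) < 2 * π ∧
      ¬ IsNPC (coneDisk n v)) ∧
    -- the theorem on full subcomplexes fails in dimension `n`
    ¬ FullSubcomplexesAreNPC n := by
  have hdim : HasDim (pentagonJoin n) n :=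
    ⟨⟨_, topSimplex_mem 0, card_topSimplex (by omega) 0⟩,
      fun s hs => card_le_of_mem_pentagonJoin (by omega) hs⟩
  have hlink := linkIsCycle_core (n := n) (by omega)
  have hinr : ∀ (v : Fin (n - 1)) i, pentagon n i ≠ Sum.inl v := fun v i => Sum.inr_ne_inl
  refine ⟨⟨hdim, ?_, card_core n, hlink.2.1, ?_, fun s hs => (mem_pentagonJoin.1 hs).2⟩, hlink,
    two_pi_lt_five_mul_arccos hn,
    fun s hs hne ℓ ρ => not_isLocallyGeodesicLoop_of_ne_core (by omega) hs hne ρ,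
    isCAT0_pentagonJoin hn, isEmptyPolygon_pentagon (by omega), ?_, ?_,
    fun D hD => hD.injOn (by omega), fun v => ⟨isFull_coneDisk v, ?_, fun w => ?_, ?_, ?_,
    linkIsCycle_coneDisk v, by linarith [pi_pos], not_isNPC_coneDisk v⟩,
    not_fullSubcomplexesAreNPC hn hdim⟩
  · exact mem_pentagonJoin.2 ⟨core_nonempty (by omega), 0, core_subset_topSimplex 0⟩
  · ext s
    constructor
    · rintro ⟨hs, hcard⟩
      obtain ⟨-, i, hi⟩ := mem_pentagonJoin.1 hs
      exact ⟨i, (Finset.eq_of_subset_of_card_le hi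
        (by rw [card_topSimplex (by omega), hcard])).symm⟩
    · rintro ⟨i, rfl⟩
      exact ⟨topSimplex_mem i, card_topSimplex (by omega) i⟩
  · ext L
    constructor
    · rintro ⟨D, hD, rfl⟩
      exact hD.exists_image_eq (by omega)
    · rintro ⟨v, rfl⟩
      exact ⟨_, spanningConeDisk_isMinimal v, spanningConeDisk_image v⟩
  · rw [← image_univ, ncard_image_of_injective _ coneDisk_injective, ncard_univ, Nat.card_fin]
  · rw [coneDisk_eq]
    exact isSimplicialDisk_coneCycle pentagon_injective (hinr v)
  · rw [coneDisk_eq, singleton_mem_coneCycle]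
  · exact coneCycle_triangle_injective pentagon_injective (hinr v)
  · rw [coneDisk_eq]
    exact coneCycle_triangles pentagon_injective (hinr v)
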